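/- Let $S_1,S_2$ be two isometries in a nonzero unital C*-algebra with $S_1S_1^*+S_2S_2^*=1$, and let $\mathcal{O}_2=C^*(S_1,S_2)$ be the C*-algebra they generate (the Cuntz algebra). Then there is a unique $*$-automorphism $\sigma$ of $\mathcal{O}_2$ with $\sigma(S_1)=S_2$ and $\sigma(S_2)=S_1$, and the C*-crossed product $\mathcal{O}_2\rtimes_\sigma\mathbb{Z}$, i.e. the universal C*-algebra generated by a copy of $\mathcal{O}_2$ and a unitary $U$ such that $UaU^*=\sigma(a)$ for all $a\in\mathcal{O}_2$, is $*$-isomorphic to $$\left\{ f\in C([-1,1],\mathcal{O}_2) : f(-1)=\sigma(f(1))\right\}.$$ -/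

import Mathlib

open scoped ENNReal

universe u

noncomputable section

/-- `S₁, S₂` are isometries satisfying the Cuntz relation `S₁S₁* + S₂S₂* = 1`, and they generate `A`
as a unital C⋆-algebra; that is, `A = C⋆(S₁, S₂)`. For nonzero `A` this says that `A` is the Cuntz
algebra `𝒪₂` with standard generators `S₁, S₂`. -/
structure IsCuntzPair {A : Type u} [CStarAlgebra A] (S₁ S₂ : A) : Prop where
  isometry₁ : star S₁ * S₁ = 1
  isometry₂ : star S₂ * S₂ = 1
  cuntz_relation : S₁ * star S₁ + S₂ * star S₂ = 1
  generates : (StarAlgebra.adjoin ℂ ({S₁, S₂} : Set A)).topologicalClosure = ⊤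

/-- A covariant pair for the automorphism `σ` of `A`: a unital ⋆-homomorphism `φ` from `A` to a
nonzero unital C⋆-algebra `C`, and a unitary `V` of `C` with `V φ(a) V* = φ(σ a)` for all `a`. -/
structure CovariantPair {A : Type u} [CStarAlgebra A] (σ : A ≃⋆ₐ[ℂ] A) : Type (u + 1) where
  C : Type u
  [cstar : CStarAlgebra C]
  [nontriv : Nontrivial C]
  φ : A →⋆ₐ[ℂ] C
  V : unitary C
  covariant : ∀ a : A, (V : C) * φ a * star (V : C) = φ (σ a)

attribute [instance] CovariantPair.cstar CovariantPair.nontriv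

namespace CrossedProduct

variable {A : Type u} [CStarAlgebra A] (σ : A ≃⋆ₐ[ℂ] A)

/-- The C⋆-algebra of bounded families `(c_p)`, `c_p ∈ p.C`, indexed by all covariant pairs `p`,
with coordinatewise operations and the supremum norm. -/
abbrev Ambient : Type (u + 1) := lp (fun p : CovariantPair σ => p.C) ∞

/-- The universal copy of `A`: the family `(p.φ a)_p`. -/
def base : A →⋆ₐ[ℂ] Ambient σ where
  toFun a := ⟨fun p => p.φ a, memℓp_infty ⟨‖a‖, by
    rintro _ ⟨p, rfl⟩
    exact NonUnitalStarAlgHom.norm_apply_le p.φ a⟩⟩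
  map_one' := by ext p; exact map_one p.φ
  map_mul' a b := by ext p; exact map_mul p.φ a b
  map_zero' := by ext p; exact map_zero p.φ
  map_add' a b := by ext p; exact map_add p.φ a b
  commutes' r := by ext p; exact AlgHomClass.commutes p.φ r
  map_star' a := by ext p; exact map_star p.φ a

/-- The universal unitary: the family `(p.V)_p`. -/
def unitaryElt : Ambient σ :=
  ⟨fun p => (p.V : p.C), memℓp_infty ⟨1, by
    rintro _ ⟨p, rfl⟩
    exact (CStarRing.norm_coe_unitary p.V).le⟩⟩

/-- The C⋆-crossed product `A ⋊_σ ℤ`: the universal C⋆-algebra generated by a copy of `A` and a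
unitary `U` with `U a U* = σ(a)` for `a ∈ A`. It is the closed unital ⋆-subalgebra generated by the
direct sum of all covariant pairs. -/
def carrier : StarSubalgebra ℂ (Ambient σ) :=
  (StarAlgebra.adjoin ℂ (Set.range (base σ) ∪ {unitaryElt σ})).topologicalClosure

end CrossedProduct

/-- The C⋆-crossed product `A ⋊_σ ℤ`. -/
abbrev CrossedProduct {A : Type u} [CStarAlgebra A] (σ : A ≃⋆ₐ[ℂ] A) : Type (u + 1) :=
  CrossedProduct.carrier σ

/-- The C⋆-algebra `{f ∈ C([-1,1], A) : f(-1) = σ(f(1))}`, a unital ⋆-subalgebra of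
`C([-1,1], A)`. -/
def twistedPaths {A : Type u} [CStarAlgebra A] (σ : A ≃⋆ₐ[ℂ] A) :
    StarSubalgebra ℂ C(Set.Icc (-1 : ℝ) 1, A) where
  carrier := {f | f ⟨-1, by norm_num⟩ = σ (f ⟨1, by norm_num⟩)}
  mul_mem' {f g} hf hg := by simp_all
  add_mem' {f g} hf hg := by simp_all
  algebraMap_mem' r := (AlgHomClass.commutes σ r).symm
  star_mem' {f} hf := by simp_all [map_star]

end

/-! Two facts carry the proof. The first is Cuntz's uniqueness theorem,
`IsCuntzPair.exists_starAlgHom`. The mean over the gauge rotations Sᵢ ↦ zSᵢ is faithful, and on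
polynomials in the generators it is a compression by an isometry of the algebra with values in a
matrix algebra. Every representation on a nonzero algebra therefore respects it and is faithful. The
flip comes from sending (S₁, S₂) to (S₂, S₁).

The second is that the flip is a dual action (`IsCuntzPair.exists_dualPair`). Put W = S₁S₁* − S₂S₂*,
a self-adjoint unitary with σ(W) = −W, and X = (S₁ + S₂)/√2. Then X and WXW are σ-fixed and satisfy
the Cuntz relation, so uniqueness embeds 𝒪₂ by some φ into the fixed points, with Wφ(a)W* = φ(σ(a)).

Hence a ↦ φ(a) (constant) and U ↦ exp(iπt/2)W is a covariant pair on paths. Since the phase is ±i at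
t = ±1 and σ(W) = −W, its values are twisted paths. It is injective because averaging over t and σ
isolates the degree-zero coefficient, just as the dual circle action does
(`DualPair.pathHom_injective`). It is surjective because U² becomes the scalar path exp(iπt), which
generates all scalar functions with equal end values, while φ(𝒪₂) and Wφ(𝒪₂) supply the σ-even and
σ-odd parts (`twistedPaths_le`). -/

noncomputable section

open MeasureTheory AddCircle

/-! ### Averaging over the circle. -/

section Mean

variable {N : Type*} [CStarAlgebra N]

theorem ContinuousMap.integrable_haar (f : C(UnitAddCircle, N)) :
    Integrable f (haarAddCircle (T := 1)) :=
  f.continuous.integrable_of_hasCompactSupport (HasCompactSupport.of_compactSpace f)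

/-- The mean of a continuous function on the circle. -/
def circleMean : C(UnitAddCircle, N) →L[ℂ] N :=
  LinearMap.mkContinuous
    { toFun := fun f => ∫ t, f t ∂(haarAddCircle (T := 1))
      map_add' := fun f g => integral_add f.integrable_haar g.integrable_haar
      map_smul' := fun c f => integral_smul c (fun t => f t) } 1
    fun f => by
      refine (norm_integral_le_of_norm_le_const (C := ‖f‖)
        (Filter.Eventually.of_forall fun t => f.norm_coe_le_norm t)).trans ?_
      simp

theorem circleMean_apply (f : C(UnitAddCircle, N)) :
    circleMean f = ∫ t, f t ∂(haarAddCircle (T := 1)) := rfl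

/-- The function `t ↦ exp (2πi n t) a` on the circle. -/
def gaugeOrbit (n : ℤ) (a : N) : C(UnitAddCircle, N) :=
  ⟨fun t => fourier n t • a, by fun_prop⟩

@[simp]
theorem gaugeOrbit_apply (n : ℤ) (a : N) (t : UnitAddCircle) :
    gaugeOrbit n a t = fourier n t • a := rfl

@[simp]
theorem gaugeOrbit_apply_zero (n : ℤ) (a : N) : gaugeOrbit n a 0 = a := by
  rw [gaugeOrbit_apply, fourier_eval_zero, one_smul]

theorem gaugeOrbit_mul (m n : ℤ) (a b : N) :
    gaugeOrbit m a * gaugeOrbit n b = gaugeOrbit (m + n) (a * b) := by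
  ext t
  simp only [ContinuousMap.mul_apply, gaugeOrbit_apply, fourier_add, smul_mul_smul_comm]

theorem star_gaugeOrbit (n : ℤ) (a : N) : star (gaugeOrbit n a) = gaugeOrbit (-n) (star a) := by
  ext t
  simp only [ContinuousMap.star_apply, gaugeOrbit_apply, star_smul, fourier_neg]
  rfl

theorem gaugeOrbit_zero_one : gaugeOrbit 0 (1 : N) = 1 := by
  ext t
  simp only [gaugeOrbit_apply, fourier_zero, one_smul, ContinuousMap.one_apply]

theorem integral_fourier (n : ℤ) :
    ∫ t, fourier n t ∂(haarAddCircle (T := 1)) = if n = 0 then 1 else 0 := by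
  split_ifs with h
  · simp [h]
  · exact integral_eq_zero_of_add_right_eq_neg
      (fourier_add_half_inv_index h Fact.out)

theorem circleMean_gaugeOrbit (n : ℤ) (a : N) :
    circleMean (gaugeOrbit n a) = if n = 0 then a else 0 := by
  rw [circleMean_apply]
  simp only [gaugeOrbit_apply]
  rw [integral_smul_const, integral_fourier]
  split_ifs <;> simp

/-- The mean is faithful: near s the positive function g = f*f is at least g(s) − ε. Integrating
over that open set, which has positive measure, gives g(s) ≤ ε. -/
theorem eq_zero_of_circleMean_star_mul_self (f : C(UnitAddCircle, N))
    (hf : circleMean (star f * f) = 0) : f = 0 := by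
  let := CStarAlgebra.spectralOrder N
  have := CStarAlgebra.spectralOrderedRing N
  ext s
  set g : C(UnitAddCircle, N) := star f * f with hg
  have hpos : ∀ t, 0 ≤ g t := fun t => star_mul_self_nonneg (f t)
  have key : ∀ ε : ℝ, 0 < ε → g s ≤ algebraMap ℝ N ε := by
    intro ε hε
    set c : N := g s - algebraMap ℝ N ε with hc
    set O : Set UnitAddCircle := {t | ‖g t - g s‖ < ε} with hO
    have hOo : IsOpen O := isOpen_lt (by fun_prop) continuous_const
    have hle : ∀ t ∈ O, c ≤ g t := by
      intro t ht
      have hsa : IsSelfAdjoint (g s - g t) :=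
        (IsSelfAdjoint.of_nonneg (hpos s)).sub (IsSelfAdjoint.of_nonneg (hpos t))
      have h1 := hsa.le_algebraMap_norm_self
      have h2 : algebraMap ℝ N ‖g s - g t‖ ≤ algebraMap ℝ N ε :=
        algebraMap_mono N (by rw [norm_sub_rev]; exact le_of_lt ht)
      have h3 := h1.trans h2
      rw [hc]
      rw [sub_le_iff_le_add] at h3 ⊢
      rwa [add_comm]
    have hI := g.integrable_haar
    have h1 := setIntegral_ge_of_const_le (μ := haarAddCircle (T := 1)) hOo.measurableSet
      (measure_ne_top _ _) hle hI.integrableOn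
    have h2 : ∫ t in O, g t ∂(haarAddCircle (T := 1)) ≤ ∫ t, g t ∂(haarAddCircle (T := 1)) :=
      setIntegral_le_integral hI (Filter.Eventually.of_forall hpos)
    rw [circleMean_apply] at hf
    have h3 := h1.trans (h2.trans hf.le)
    have hμ : 0 < (haarAddCircle (T := 1)).real O := by
      rw [measureReal_def]
      refine ENNReal.toReal_pos (hOo.measure_pos _ ⟨s, ?_⟩).ne' (measure_ne_top _ _)
      simpa [hO] using hε
    have h4 : c ≤ 0 := by
      have := smul_le_smul_of_nonneg_left h3 (inv_nonneg.2 hμ.le)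
      rwa [smul_smul, inv_mul_cancel₀ hμ.ne', one_smul, smul_zero] at this
    rwa [hc, sub_nonpos] at h4
  have hnorm : ‖g s‖ ≤ 0 := by
    refine le_of_forall_pos_le_add fun ε hε => ?_
    rw [zero_add]
    exact (CStarAlgebra.norm_le_iff_le_algebraMap (g s) hε.le (hpos s)).2 (key ε hε)
  have h0 : star (f s) * f s = 0 := norm_le_zero_iff.1 hnorm
  exact CStarRing.star_mul_self_eq_zero_iff _ |>.1 h0

end Mean

/-! ### The Cuntz relation. -/

/-- A pair of isometries satisfying the Cuntz relation. -/
structure CuntzRel {N : Type*} [CStarAlgebra N] (s : Fin 2 → N) : Prop where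
  orthonormal : ∀ i j, star (s i) * s j = if i = j then 1 else 0
  sum_mul_star : ∑ i, s i * star (s i) = 1

/-- Compressing the relation by a gives 1 = 1 + (a*b)(a*b)*, which forces a*b = 0. -/
theorem CuntzRel.of_isometries {N : Type*} [CStarAlgebra N] {a b : N} (ha : star a * a = 1)
    (hb : star b * b = 1) (hab : a * star a + b * star b = 1) : CuntzRel ![a, b] := by
  have h0 : star a * b = 0 := by
    have h1 : star a * (a * star a + b * star b) * a = 1 := by rw [hab, mul_one, ha]
    have h2 : star a * (a * star a + b * star b) * a
        = (star a * a) * (star a * a) + (star a * b) * star (star a * b) := by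
      simp only [StarMul.star_mul, star_star]
      noncomm_ring
    rw [h2, ha, one_mul, add_eq_left] at h1
    exact (CStarRing.mul_star_self_eq_zero_iff _).1 h1
  have h0' : star b * a = 0 := by simpa using congrArg star h0
  refine ⟨?_, by simpa using hab⟩
  intro i j
  fin_cases i <;> fin_cases j <;> simp [ha, hb, h0, h0']

/-! ### Words, compressing isometries and matrix algebras. -/

section Words

variable {N : Type*} [CStarAlgebra N] {s : Fin 2 → N}

/-- The product of the generators along a word. -/
def cuntzWord (s : Fin 2 → N) (μ : List (Fin 2)) : N := (μ.map s).prod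

@[simp]
theorem cuntzWord_nil : cuntzWord s [] = 1 := rfl

@[simp]
theorem cuntzWord_cons (i : Fin 2) (μ : List (Fin 2)) :
    cuntzWord s (i :: μ) = s i * cuntzWord s μ := by simp [cuntzWord]

theorem cuntzWord_append (μ ν : List (Fin 2)) :
    cuntzWord s (μ ++ ν) = cuntzWord s μ * cuntzWord s ν := by simp [cuntzWord]

namespace CuntzRel

variable (hs : CuntzRel s)
include hs

/-- The canonical endomorphism `x ↦ ∑ sᵢ x sᵢ*`. -/
def shift : N →⋆ₐ[ℂ] N where
  toFun x := ∑ i, s i * x * star (s i)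
  map_one' := by simpa using hs.sum_mul_star
  map_mul' x y := by
    have h : ∀ i j, (s i * x * star (s i)) * (s j * y * star (s j))
        = s i * x * (star (s i) * s j) * y * star (s j) := by intros; noncomm_ring
    simp only [Finset.sum_mul_sum, h, hs.orthonormal]
    simp [mul_assoc]
  map_zero' := by simp
  map_add' x y := by simp [mul_add, add_mul, Finset.sum_add_distrib]
  commutes' r := by
    simp only [Algebra.algebraMap_eq_smul_one, mul_smul_comm, smul_mul_assoc, mul_one,
      ← Finset.smul_sum, hs.sum_mul_star]
  map_star' x := by simp [mul_assoc]

theorem shift_mul_gen (x : N) (i : Fin 2) : hs.shift x * s i = s i * x := by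
  change (∑ j, s j * x * star (s j)) * s i = s i * x
  simp only [Finset.sum_mul, mul_assoc, hs.orthonormal]
  simp

theorem iterate_shift_mul_word (x : N) (μ : List (Fin 2)) :
    hs.shift^[μ.length] x * cuntzWord s μ = cuntzWord s μ * x := by
  induction μ with
  | nil => simp
  | cons i μ ih =>
    rw [List.length_cons, Function.iterate_succ_apply', cuntzWord_cons, ← mul_assoc,
      hs.shift_mul_gen, mul_assoc, ih, mul_assoc]

theorem star_word_mul_iterate_shift (x : N) (μ : List (Fin 2)) :
    star (cuntzWord s μ) * hs.shift^[μ.length] x = x * star (cuntzWord s μ) := by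
  have h := congrArg star (hs.iterate_shift_mul_word (star x) μ)
  have h2 : hs.shift^[μ.length] (star x) = star (hs.shift^[μ.length] x) :=
    (Function.Semiconj.iterate_right (f := star) (ga := hs.shift) (gb := hs.shift)
      (fun y => (map_star hs.shift y).symm) μ.length x).symm
  simpa [h2] using h

theorem iterate_shift_star (n : ℕ) (x : N) :
    hs.shift^[n] (star x) = star (hs.shift^[n] x) :=
  (Function.Semiconj.iterate_right (f := star) (ga := hs.shift) (gb := hs.shift)
      (fun y => (map_star hs.shift y).symm) n x).symm

theorem star_word_mul_word (μ : List (Fin 2)) : star (cuntzWord s μ) * cuntzWord s μ = 1 := by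
  induction μ with
  | nil => simp
  | cons i μ ih =>
    rw [cuntzWord_cons, StarMul.star_mul, mul_assoc, ← mul_assoc _ (s i), hs.orthonormal,
      if_pos rfl, one_mul, ih]

/-- The isometry `s₁ⁿ s₂`. -/
def probe (_ : CuntzRel s) (n : ℕ) : N := cuntzWord s (List.replicate n 0) * s 1

theorem star_probe_mul_probe (n : ℕ) : star (hs.probe n) * hs.probe n = 1 := by
  rw [probe, StarMul.star_mul, mul_assoc, ← mul_assoc _ _ (s 1), hs.star_word_mul_word, one_mul,
    hs.orthonormal, if_pos rfl]

/-- The word `s 0`ⁿ `s 1` does not overlap a proper shift of itself. Moving the shift past the first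
k letters leaves (`s 0`ᵏ `s 1`)* `s 1`, which vanishes because k ≥ 1. -/
theorem shift_star_probe_mul_probe {n k : ℕ} (hk : 1 ≤ k) (hkn : k ≤ n) :
    hs.shift^[k] (star (hs.probe n)) * hs.probe n = 0 := by
  obtain ⟨m, rfl⟩ := Nat.exists_eq_add_of_le hkn
  obtain ⟨j, rfl⟩ := Nat.exists_eq_add_of_le' hk
  set W := fun n => cuntzWord s (List.replicate n 0) with hW
  have h1 : ∀ a b, W (a + b) = W a * W b := fun a b => by
    rw [hW]; simp only [List.replicate_add, cuntzWord_append]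
  have h2 : hs.probe (j + 1 + m) = W (j + 1) * (W m * s 1) := by
    rw [← mul_assoc, ← h1]; rfl
  have h3 : star (hs.probe (j + 1 + m)) * (W m * s 1) = 0 := by
    have : hs.probe (j + 1 + m) = W m * (s 0 * (W j * s 1)) := by
      change W (j + 1 + m) * s 1 = _
      rw [show j + 1 + m = m + (1 + j) by ring, h1, h1]
      simp [hW, mul_assoc]
    rw [this, StarMul.star_mul, mul_assoc, ← mul_assoc _ (W m), hs.star_word_mul_word, one_mul,
      StarMul.star_mul, mul_assoc, hs.orthonormal]
    simp
  have h4 := hs.iterate_shift_mul_word (star (hs.probe (j + 1 + m))) (List.replicate (j + 1) 0)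
  rw [List.length_replicate] at h4
  nth_rewrite 2 [h2]
  rw [← mul_assoc, h4, mul_assoc, h3, mul_zero]

/-- An isometry whose compression kills the monomials of nonzero degree. -/
def compressor (n : ℕ) : N := hs.shift^[n] (hs.probe n)

theorem star_compressor_mul (n : ℕ) : star (hs.compressor n) * hs.compressor n = 1 := by
  rw [compressor, ← hs.iterate_shift_star, ← iterate_map_mul, hs.star_probe_mul_probe,
    iterate_map_one]

/-- Each compressor slides past one word and loses as many shifts as the word has letters. Equal
lengths leave w*w = 1; unequal lengths leave a shift of the non-overlap product. -/
theorem compress {n : ℕ} {μ ν : List (Fin 2)} (hμ : μ.length ≤ n) (hν : ν.length ≤ n) :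
    star (hs.compressor n) * (cuntzWord s μ * star (cuntzWord s ν)) * hs.compressor n =
      if μ.length = ν.length then cuntzWord s μ * star (cuntzWord s ν) else 0 := by
  set w := hs.probe n with hw
  have main : star (hs.compressor n) * (cuntzWord s μ * star (cuntzWord s ν)) * hs.compressor n =
      cuntzWord s μ * (hs.shift^[n - μ.length] (star w) * hs.shift^[n - ν.length] w) *
        star (cuntzWord s ν) := by
    have h1 : star (hs.compressor n) * cuntzWord s μ
        = cuntzWord s μ * hs.shift^[n - μ.length] (star w) := by
      rw [← hs.iterate_shift_mul_word, ← Function.iterate_add_apply, Nat.add_sub_cancel' hμ,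
        hs.iterate_shift_star, compressor]
    have h2 : star (cuntzWord s ν) * hs.compressor n
        = hs.shift^[n - ν.length] w * star (cuntzWord s ν) := by
      rw [← hs.star_word_mul_iterate_shift, ← Function.iterate_add_apply, Nat.add_sub_cancel' hν,
        compressor]
    calc _ = (star (hs.compressor n) * cuntzWord s μ) * (star (cuntzWord s ν) * hs.compressor n) :=
          by noncomm_ring
      _ = _ := by rw [h1, h2]; noncomm_ring
  rw [main]
  split_ifs with h
  · rw [h, ← iterate_map_mul, hs.star_probe_mul_probe, iterate_map_one, mul_one]
  · have : hs.shift^[n - μ.length] (star w) * hs.shift^[n - ν.length] w = 0 := by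
      rcases lt_or_gt_of_ne h with h | h
      · have e : n - μ.length = (n - ν.length) + (ν.length - μ.length) := by omega
        rw [e, Function.iterate_add_apply, ← iterate_map_mul,
          hs.shift_star_probe_mul_probe (by omega) (by omega), iterate_map_zero]
      · have e : n - ν.length = (n - μ.length) + (μ.length - ν.length) := by omega
        have h0 := congrArg star (hs.shift_star_probe_mul_probe (n := n)
          (k := μ.length - ν.length) (by omega) (by omega))
        rw [hs.iterate_shift_star, StarMul.star_mul, star_star, star_zero] at h0
        rw [e, Function.iterate_add_apply, ← iterate_map_mul, h0, iterate_map_zero]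
    rw [this]; simp

/-- The elements whose matrix coefficients lie in a given subalgebra. -/
def amplify (K : StarSubalgebra ℂ N) : StarSubalgebra ℂ N where
  carrier := {x | ∀ i j, star (s i) * x * s j ∈ K}
  mul_mem' {x y} hx hy i j := by
    have : star (s i) * (x * y) * s j
        = ∑ k, (star (s i) * x * s k) * (star (s k) * y * s j) := by
      have : ∀ k, (star (s i) * x * s k) * (star (s k) * y * s j)
          = (star (s i) * x) * (s k * star (s k)) * (y * s j) := by intros; noncomm_ring
      simp only [this, ← Finset.sum_mul, ← Finset.mul_sum, hs.sum_mul_star]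
      noncomm_ring
    rw [this]
    exact sum_mem fun k _ => mul_mem (hx i k) (hy k j)
  add_mem' {x y} hx hy i j := by
    rw [mul_add, add_mul]; exact add_mem (hx i j) (hy i j)
  algebraMap_mem' r i j := by
    rw [Algebra.algebraMap_eq_smul_one, mul_smul_comm, smul_mul_assoc, mul_one, hs.orthonormal]
    split_ifs
    · exact K.smul_mem (one_mem K) r
    · simp
  star_mem' {x} hx i j := by
    have := star_mem (hx j i)
    simpa [mul_assoc] using this

theorem mem_amplify {K : StarSubalgebra ℂ N} {x : N} :
    x ∈ hs.amplify K ↔ ∀ i j, star (s i) * x * s j ∈ K := Iff.rfl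

/-- The increasing sequence of full matrix algebras of size `2ⁿ`. -/
def level : ℕ → StarSubalgebra ℂ N
  | 0 => ⊥
  | n + 1 => hs.amplify (level n)

theorem isClosed_level (n : ℕ) : IsClosed (hs.level n : Set N) := by
  induction n with
  | zero =>
    have : ((hs.level 0 : StarSubalgebra ℂ N) : Set N) = (Submodule.span ℂ {(1 : N)} : Set N) := by
      ext x
      simp [level, Submodule.mem_span_singleton,
        Algebra.algebraMap_eq_smul_one]
    rw [this]
    exact Submodule.closed_of_finiteDimensional _
  | succ n ih =>
    have : ((hs.level (n + 1) : StarSubalgebra ℂ N) : Set N)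
        = ⋂ i, ⋂ j, (fun x => star (s i) * x * s j) ⁻¹' (hs.level n : Set N) := by
      ext x; simp [level, mem_amplify]
    rw [this]
    exact isClosed_iInter fun i => isClosed_iInter fun j => ih.preimage (by fun_prop)

theorem level_mono : Monotone hs.level := by
  refine monotone_nat_of_le_succ fun n => ?_
  induction n with
  | zero => exact bot_le
  | succ n ih => exact fun x hx i j => ih (hx i j)

theorem word_mul_star_mem_level (μ ν : List (Fin 2)) (h : μ.length = ν.length) :
    cuntzWord s μ * star (cuntzWord s ν) ∈ hs.level μ.length := by
  induction μ generalizing ν with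
  | nil =>
    obtain rfl : ν = [] := by simpa using h.symm
    simp
  | cons a μ ih =>
    obtain ⟨b, ν, rfl⟩ : ∃ b ν', ν = b :: ν' := by
      cases ν with
      | nil => simp at h
      | cons b ν => exact ⟨b, ν, rfl⟩
    have h' : μ.length = ν.length := by simpa using h
    intro i j
    have e : star (s i) * (cuntzWord s (a :: μ) * star (cuntzWord s (b :: ν))) * s j
        = (star (s i) * s a) * (cuntzWord s μ * star (cuntzWord s ν)) * (star (s b) * s j) := by
      simp only [cuntzWord_cons, StarMul.star_mul]
      noncomm_ring
    rw [e, hs.orthonormal, hs.orthonormal]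
    split_ifs
    · simpa using ih ν h'
    all_goals simp

/-- An element is recovered from its matrix coefficients, which lie one level down. At the bottom
are scalars, on which π is injective since `B` is nonzero. -/
theorem eq_zero_of_map_eq_zero {B : Type*} [CStarAlgebra B] [Nontrivial B] (π : N →⋆ₐ[ℂ] B)
    (n : ℕ) {x : N} (hx : x ∈ hs.level n) (h : π x = 0) : x = 0 := by
  induction n generalizing x with
  | zero =>
    obtain ⟨c, rfl⟩ : ∃ c, algebraMap ℂ N c = x := by
      simpa [level, StarSubalgebra.mem_bot] using hx
    rw [AlgHomClass.commutes, FaithfulSMul.algebraMap_eq_zero_iff] at h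
    rw [h, map_zero]
  | succ n ih =>
    have h0 : ∀ i j, star (s i) * x * s j = 0 := fun i j =>
      ih (hx i j) (by simp [h])
    calc x = (∑ i, s i * star (s i)) * x * (∑ j, s j * star (s j)) := by
          simp [hs.sum_mul_star]
      _ = ∑ i, ∑ j, s i * (star (s i) * x * s j) * star (s j) := by
          simp only [Finset.sum_mul, Finset.mul_sum]
          rw [Finset.sum_comm]
          simp only [mul_assoc]
      _ = 0 := by simp [h0]

/-- Closedness makes each level a C⋆-algebra, so injectivity upgrades to isometry. -/
theorem norm_map_of_mem_level {B : Type*} [CStarAlgebra B] [Nontrivial B] (π : N →⋆ₐ[ℂ] B)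
    (n : ℕ) {x : N} (hx : x ∈ hs.level n) : ‖π x‖ = ‖x‖ := by
  have := hs.isClosed_level n
  exact NonUnitalStarAlgHom.norm_map (π.comp (hs.level n).subtype)
    ((injective_iff_map_eq_zero _).2 fun y hy =>
      Subtype.ext (hs.eq_zero_of_map_eq_zero π n y.2 hy)) ⟨x, hx⟩

end CuntzRel
end Words

/-- Evaluation of continuous functions at a point. -/
def ContinuousMap.evalStarHom {X N : Type*} [TopologicalSpace X] [CStarAlgebra N] (x : X) :
    C(X, N) →⋆ₐ[ℂ] N where
  toFun f := f x
  map_one' := rfl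
  map_mul' _ _ := rfl
  map_zero' := rfl
  map_add' _ _ := rfl
  commutes' _ := rfl
  map_star' _ := rfl

/-! ### Gauge orbits and faithfulness of representations. -/

section GaugeAlgebra

variable {N : Type*} [CStarAlgebra N] {s : Fin 2 → N}

/-- The C⋆-algebra of functions on the circle generated by the gauge orbits of the generators. -/
def gaugeAlgebra (s : Fin 2 → N) : StarSubalgebra ℂ C(UnitAddCircle, N) :=
  (StarAlgebra.adjoin ℂ (Set.range fun i => gaugeOrbit 1 (s i))).topologicalClosure

instance isClosed_gaugeAlgebra (s : Fin 2 → N) :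
    IsClosed (gaugeAlgebra s : Set C(UnitAddCircle, N)) :=
  StarSubalgebra.isClosed_topologicalClosure _

theorem gaugeOrbit_gen_mem (s : Fin 2 → N) (i : Fin 2) : gaugeOrbit 1 (s i) ∈ gaugeAlgebra s :=
  StarSubalgebra.le_topologicalClosure _ (StarAlgebra.subset_adjoin _ _ ⟨i, rfl⟩)

/-- The gauge orbit of the monomial `s_μ s_ν*`. -/
def gaugeMonomial (s : Fin 2 → N) (μ ν : List (Fin 2)) : C(UnitAddCircle, N) :=
  gaugeOrbit (μ.length - ν.length) (cuntzWord s μ * star (cuntzWord s ν))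

namespace CuntzRel

variable (hs : CuntzRel s)
include hs

theorem eq_monomial_of_mem_closure {f : C(UnitAddCircle, N)}
    (hf : f ∈ Submonoid.closure ((Set.range fun i => gaugeOrbit 1 (s i)) ∪
      star (Set.range fun i => gaugeOrbit 1 (s i)))) :
    f = 0 ∨ ∃ μ ν, f = gaugeMonomial s μ ν := by
  induction hf using Submonoid.closure_induction_left with
  | one => exact Or.inr ⟨[], [], by simp [gaugeMonomial, gaugeOrbit_zero_one]⟩
  | mul_left x hx y hy ih =>
    rcases ih with rfl | ⟨μ, ν, rfl⟩
    · simp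
    rcases hx with ⟨i, rfl⟩ | ⟨i, hi⟩
    · refine Or.inr ⟨i :: μ, ν, ?_⟩
      simp only [gaugeMonomial, gaugeOrbit_mul, cuntzWord_cons, List.length_cons, mul_assoc]
      congr 1
      push_cast; ring
    · obtain rfl : x = gaugeOrbit (-1) (star (s i)) := by
        rw [← star_gaugeOrbit]; exact (star_eq_iff_star_eq.1 hi.symm).symm
      cases μ with
      | nil =>
        refine Or.inr ⟨[], ν ++ [i], ?_⟩
        simp only [gaugeMonomial, gaugeOrbit_mul, cuntzWord_append, cuntzWord_cons, cuntzWord_nil,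
          StarMul.star_mul, List.length_append, List.length_cons, List.length_nil, mul_one, one_mul]
        congr 1
        push_cast; ring
      | cons j μ =>
        have e : star (s i) * (cuntzWord s (j :: μ) * star (cuntzWord s ν)) =
            (star (s i) * s j) * (cuntzWord s μ * star (cuntzWord s ν)) := by
          simp only [cuntzWord_cons, mul_assoc]
        rw [gaugeMonomial, gaugeOrbit_mul, e, hs.orthonormal]
        split_ifs
        · refine Or.inr ⟨μ, ν, ?_⟩
          rw [gaugeMonomial, one_mul]
          congr 1
          simp only [List.length_cons]; push_cast; ring
        · left; ext t; simp

/-- Mean and compression agree on monomials: both keep degree zero and kill the rest, once n bounds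
the two word lengths. -/
theorem compress_eq_circleMean {f : C(UnitAddCircle, N)}
    (hf : f ∈ StarAlgebra.adjoin ℂ (Set.range fun i => gaugeOrbit 1 (s i))) :
    ∃ n₀, ∀ n ≥ n₀, star (hs.compressor n) * f 0 * hs.compressor n = circleMean f ∧
      circleMean f ∈ hs.level n := by
  rw [← StarSubalgebra.mem_toSubalgebra, ← Subalgebra.mem_toSubmodule,
    StarAlgebra.adjoin_eq_span] at hf
  induction hf using Submodule.span_induction with
  | mem f hf =>
    rcases hs.eq_monomial_of_mem_closure hf with rfl | ⟨μ, ν, rfl⟩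
    · exact ⟨0, fun n _ => by simp⟩
    · refine ⟨max μ.length ν.length, fun n hn => ?_⟩
      have hn' := max_le_iff.1 hn
      rw [gaugeMonomial, gaugeOrbit_apply_zero, circleMean_gaugeOrbit, hs.compress hn'.1 hn'.2]
      simp only [sub_eq_zero, Nat.cast_inj, true_and]
      split_ifs with h
      · exact hs.level_mono hn'.1 (hs.word_mul_star_mem_level μ ν h)
      · exact zero_mem _
  | zero => exact ⟨0, fun n _ => by simp⟩
  | add f g _ _ hf hg =>
    obtain ⟨a, ha⟩ := hf
    obtain ⟨b, hb⟩ := hg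
    refine ⟨max a b, fun n hn => ?_⟩
    have hn' := max_le_iff.1 hn
    rw [ContinuousMap.add_apply, mul_add, add_mul, (ha n hn'.1).1, (hb n hn'.2).1, map_add]
    exact ⟨rfl, add_mem (ha n hn'.1).2 (hb n hn'.2).2⟩
  | smul c f _ hf =>
    obtain ⟨a, ha⟩ := hf
    refine ⟨a, fun n hn => ?_⟩
    rw [ContinuousMap.smul_apply, mul_smul_comm, smul_mul_assoc, (ha n hn).1, map_smul]
    exact ⟨rfl, SMulMemClass.smul_mem c (ha n hn).2⟩

/-- The mean involves all of f, yet is controlled by `π (f 0)`: on the dense subalgebra it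
compresses `f 0` into a level where π is isometric. -/
theorem norm_circleMean_le {B : Type*} [CStarAlgebra B] [Nontrivial B] (π : N →⋆ₐ[ℂ] B)
    {f : C(UnitAddCircle, N)} (hf : f ∈ gaugeAlgebra s) : ‖circleMean f‖ ≤ ‖π (f 0)‖ := by
  have hπ : Continuous π := AddMonoidHomClass.continuous_of_bound π 1
    fun x => by simpa using NonUnitalStarAlgHom.norm_apply_le π x
  have hcl : IsClosed {f : C(UnitAddCircle, N) | ‖circleMean f‖ ≤ ‖π (f 0)‖} :=
    isClosed_le (by fun_prop)
      ((hπ.comp (by fun_prop : Continuous fun f : C(UnitAddCircle, N) => f 0)).norm)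
  refine hcl.closure_subset_iff.2 (fun g hg => ?_) hf
  obtain ⟨n, hn⟩ := hs.compress_eq_circleMean hg
  obtain ⟨h1, h2⟩ := hn n le_rfl
  have hv : ‖π (hs.compressor n)‖ ≤ 1 := by
    have : star (π (hs.compressor n)) * π (hs.compressor n) = 1 := by
      rw [← map_star, ← map_mul, hs.star_compressor_mul, map_one]
    have h := CStarRing.norm_star_mul_self (x := π (hs.compressor n))
    rw [this, CStarRing.norm_one] at h
    nlinarith [norm_nonneg (π (hs.compressor n))]
  calc ‖circleMean g‖ = ‖π (circleMean g)‖ := (hs.norm_map_of_mem_level π n h2).symm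
    _ = ‖star (π (hs.compressor n)) * π (g 0) * π (hs.compressor n)‖ := by
      rw [← h1, map_mul, map_mul, map_star]
    _ ≤ ‖star (π (hs.compressor n))‖ * ‖π (g 0)‖ * ‖π (hs.compressor n)‖ := by
      refine (norm_mul_le _ _).trans ?_
      gcongr
      exact norm_mul_le _ _
    _ ≤ 1 * ‖π (g 0)‖ * 1 := by
      rw [norm_star]; gcongr
    _ = ‖π (g 0)‖ := by ring

theorem eq_zero_of_map_eval_eq_zero {B : Type*} [CStarAlgebra B] [Nontrivial B] (π : N →⋆ₐ[ℂ] B)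
    {f : C(UnitAddCircle, N)} (hf : f ∈ gaugeAlgebra s) (h : π (f 0) = 0) : f = 0 := by
  refine eq_zero_of_circleMean_star_mul_self f (norm_le_zero_iff.1 ?_)
  refine (hs.norm_circleMean_le π (mul_mem (star_mem hf) hf)).trans ?_
  simp [h]

/-- Evaluation of the gauge algebra at the base point, followed by a representation. -/
def evalHom {B : Type*} [CStarAlgebra B] (_ : CuntzRel s) (π : N →⋆ₐ[ℂ] B) :
    gaugeAlgebra s →⋆ₐ[ℂ] B :=
  (π.comp (ContinuousMap.evalStarHom (0 : UnitAddCircle))).comp (gaugeAlgebra s).subtype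

theorem evalHom_injective {B : Type*} [CStarAlgebra B] [Nontrivial B] (π : N →⋆ₐ[ℂ] B) :
    Function.Injective (hs.evalHom π) :=
  (injective_iff_map_eq_zero _).2 fun f hf =>
    Subtype.ext (hs.eq_zero_of_map_eval_eq_zero π f.2 hf)

theorem evalHom_gen {B : Type*} [CStarAlgebra B] (π : N →⋆ₐ[ℂ] B) (i : Fin 2) :
    hs.evalHom π ⟨gaugeOrbit 1 (s i), gaugeOrbit_gen_mem s i⟩ = π (s i) := by
  change π (gaugeOrbit 1 (s i) 0) = _
  rw [gaugeOrbit_apply_zero]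

end CuntzRel
end GaugeAlgebra

/-! ### Uniqueness of the Cuntz algebra and the flip. -/

theorem StarAlgHom.range_eq_top_of_injective {A B : Type*} [CStarAlgebra A] [CStarAlgebra B]
    (φ : A →⋆ₐ[ℂ] B) (hφ : Function.Injective φ) {T : Set B}
    (hT : (StarAlgebra.adjoin ℂ T).topologicalClosure = ⊤) (h : T ⊆ Set.range φ) :
    Function.Surjective φ := by
  have hrange : (φ.range : Set B) = Set.range φ := rfl
  have hc : IsClosed (φ.range : Set B) := by
    rw [hrange]
    exact (NonUnitalStarAlgHom.isometry φ hφ).isClosedEmbedding.isClosed_range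
  have h1 : (StarAlgebra.adjoin ℂ T).topologicalClosure ≤ φ.range :=
    StarSubalgebra.topologicalClosure_minimal
      (StarAlgebra.adjoin_le (by rwa [hrange])) hc
  intro b
  have : b ∈ φ.range := h1 (hT ▸ StarSubalgebra.mem_top)
  exact this

theorem CuntzRel.prod {A B : Type*} [CStarAlgebra A] [CStarAlgebra B] {s : Fin 2 → A}
    {r : Fin 2 → B} (hs : CuntzRel s) (hr : CuntzRel r) : CuntzRel fun i => (s i, r i) := by
  refine ⟨fun i j => ?_, ?_⟩
  · have h1 := hs.orthonormal i j
    have h2 := hr.orthonormal i j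
    split_ifs at * <;> exact Prod.ext h1 h2
  · have h1 := hs.sum_mul_star
    have h2 := hr.sum_mul_star
    simp only [Fin.sum_univ_two] at *
    exact Prod.ext h1 h2

/-- **Cuntz's theorem**: a representation of the Cuntz relations on a nonzero C⋆-algebra induces a
faithful homomorphism on any C⋆-algebra generated by a Cuntz pair. -/
theorem IsCuntzPair.exists_starAlgHom {A B : Type*} [CStarAlgebra A] [Nontrivial A]
    [CStarAlgebra B] [Nontrivial B] {S₁ S₂ : A} (hS : IsCuntzPair S₁ S₂) {r : Fin 2 → B}
    (hr : CuntzRel r) :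
    ∃ φ : A →⋆ₐ[ℂ] B, Function.Injective φ ∧ φ S₁ = r 0 ∧ φ S₂ = r 1 := by
  have hs := CuntzRel.of_isometries hS.isometry₁ hS.isometry₂ hS.cuntz_relation
  -- The gauge algebra of the pairs (Sᵢ, rᵢ) in A × B embeds through either coordinate. The first
  -- embedding is onto A, so inverting it and applying the second gives the map.
  have ht := hs.prod hr
  set α := ht.evalHom (StarAlgHom.fst ℂ A B)
  set β := ht.evalHom (StarAlgHom.snd ℂ A B)
  have hα : Function.Injective α := ht.evalHom_injective _
  have hβ : Function.Injective β := ht.evalHom_injective _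
  obtain ⟨x, hx, hx'⟩ : ∃ x, α x = S₁ ∧ β x = r 0 :=
    ⟨_, ht.evalHom_gen (StarAlgHom.fst ℂ A B) 0, ht.evalHom_gen (StarAlgHom.snd ℂ A B) 0⟩
  obtain ⟨y, hy, hy'⟩ : ∃ y, α y = S₂ ∧ β y = r 1 :=
    ⟨_, ht.evalHom_gen (StarAlgHom.fst ℂ A B) 1, ht.evalHom_gen (StarAlgHom.snd ℂ A B) 1⟩
  have hsurj : Function.Surjective α := by
    refine α.range_eq_top_of_injective hα hS.generates ?_
    rintro _ (rfl | rfl)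
    exacts [⟨x, hx⟩, ⟨y, hy⟩]
  set e := StarAlgEquiv.ofBijective α ⟨hα, hsurj⟩
  have hex : e.symm S₁ = x := (congrArg e.symm hx.symm).trans (e.symm_apply_apply x)
  have hey : e.symm S₂ = y := (congrArg e.symm hy.symm).trans (e.symm_apply_apply y)
  refine ⟨β.comp (e.symm : A →⋆ₐ[ℂ] _), ?_, ?_, ?_⟩
  · exact hβ.comp (g := β) (f := e.symm) (EquivLike.injective e.symm)
  · exact (congrArg β hex).trans hx'
  · exact (congrArg β hey).trans hy'

theorem StarAlgHom.ext_of_adjoin_dense {A B : Type*} [CStarAlgebra A] [CStarAlgebra B] {T : Set A}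
    (hT : (StarAlgebra.adjoin ℂ T).topologicalClosure = ⊤) {φ ψ : A →⋆ₐ[ℂ] B}
    (h : ∀ a ∈ T, φ a = ψ a) : φ = ψ := by
  have hφ : Continuous φ := AddMonoidHomClass.continuous_of_bound φ 1
    fun x => by simpa using NonUnitalStarAlgHom.norm_apply_le φ x
  have hψ : Continuous ψ := AddMonoidHomClass.continuous_of_bound ψ 1
    fun x => by simpa using NonUnitalStarAlgHom.norm_apply_le ψ x
  have h1 : (StarAlgebra.adjoin ℂ T).topologicalClosure ≤ StarAlgHom.equalizer φ ψ :=
    StarSubalgebra.topologicalClosure_minimal (StarAlgebra.adjoin_le h) (isClosed_eq hφ hψ)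
  ext a
  exact h1 (hT ▸ StarSubalgebra.mem_top : a ∈ (StarAlgebra.adjoin ℂ T).topologicalClosure)

/-- The flip automorphism exchanging the two generators. -/
theorem IsCuntzPair.existsUnique_flip {A : Type*} [CStarAlgebra A] [Nontrivial A] {S₁ S₂ : A}
    (hS : IsCuntzPair S₁ S₂) : ∃! σ : A ≃⋆ₐ[ℂ] A, σ S₁ = S₂ ∧ σ S₂ = S₁ := by
  obtain ⟨φ, hφ, h1, h2⟩ := hS.exists_starAlgHom (r := ![S₂, S₁])
    (CuntzRel.of_isometries hS.isometry₂ hS.isometry₁ ((add_comm _ _).trans hS.cuntz_relation))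
  simp only [Matrix.cons_val_zero, Matrix.cons_val_one] at h1 h2
  -- φ² fixes the generators, so φ is its own inverse.
  have hφφ : φ.comp φ = StarAlgHom.id ℂ A := by
    refine StarAlgHom.ext_of_adjoin_dense hS.generates ?_
    rintro _ (rfl | rfl) <;> simp [h1, h2]
  refine ⟨StarAlgEquiv.ofBijective φ ⟨hφ, fun a => ⟨φ a, DFunLike.congr_fun hφφ a⟩⟩, ⟨h1, h2⟩, ?_⟩
  rintro τ ⟨t1, t2⟩
  have : (τ : A →⋆ₐ[ℂ] A) = φ := by
    refine StarAlgHom.ext_of_adjoin_dense hS.generates ?_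
    rintro _ (rfl | rfl)
    exacts [t1.trans h1.symm, t2.trans h2.symm]
  ext a
  exact DFunLike.congr_fun this a

/-! ### Paths with phases. -/

/-- The interval `[-1, 1]`. -/
abbrev PathInterval : Type := Set.Icc (-1 : ℝ) 1

instance : Nonempty PathInterval := ⟨⟨0, by norm_num⟩⟩

/-- Constant functions. -/
def ContinuousMap.constStarHom {X N : Type*} [TopologicalSpace X] [CStarAlgebra N] :
    N →⋆ₐ[ℂ] C(X, N) where
  toFun a := ContinuousMap.const X a
  map_one' := rfl
  map_mul' _ _ := rfl
  map_zero' := rfl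
  map_add' _ _ := rfl
  commutes' _ := rfl
  map_star' _ := rfl

@[simp]
theorem ContinuousMap.constStarHom_apply {X N : Type*} [TopologicalSpace X] [CStarAlgebra N]
    (a : N) (x : X) : (ContinuousMap.constStarHom a : C(X, N)) x = a := rfl

section PathOrbit

variable {A : Type u} [CStarAlgebra A]

/-- The function `t ↦ exp (iπkt/2)` on `[-1, 1]`. -/
def phase (k : ℤ) (t : ℝ) : ℂ := Complex.exp (k * (Real.pi * Complex.I / 2) * t)

@[fun_prop]
theorem continuous_phase (k : ℤ) : Continuous (phase k) := by unfold phase; fun_prop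

theorem phase_add (j k : ℤ) (t : ℝ) : phase (j + k) t = phase j t * phase k t := by
  rw [phase, phase, phase, ← Complex.exp_add]; congr 1; push_cast; ring

@[simp]
theorem phase_zero (t : ℝ) : phase 0 t = 1 := by simp [phase]

theorem star_phase (k : ℤ) (t : ℝ) : star (phase k t) = phase (-k) t := by
  rw [phase, phase, ← starRingEnd_apply, ← Complex.exp_conj]
  congr 1
  simp only [map_mul, map_div₀, map_intCast, Complex.conj_ofReal, Complex.conj_I, map_ofNat]
  push_cast; ring

/-- The function `t ↦ exp (iπkt/2) a` on `[-1, 1]`. -/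
def pathOrbit (k : ℤ) (a : A) : C(PathInterval, A) := ⟨fun t => phase k t • a, by fun_prop⟩

@[simp]
theorem pathOrbit_apply (k : ℤ) (a : A) (t : PathInterval) :
    pathOrbit k a t = phase k t • a := rfl

theorem pathOrbit_mul (j k : ℤ) (a b : A) :
    pathOrbit j a * pathOrbit k b = pathOrbit (j + k) (a * b) := by
  ext t
  simp only [ContinuousMap.mul_apply, pathOrbit_apply, phase_add, smul_mul_smul_comm]

theorem star_pathOrbit (k : ℤ) (a : A) : star (pathOrbit k a) = pathOrbit (-k) (star a) := by
  ext t
  simp only [ContinuousMap.star_apply, pathOrbit_apply, star_smul, star_phase]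

theorem pathOrbit_zero (a : A) : pathOrbit 0 a = ContinuousMap.constStarHom a := by
  ext t; simp

theorem continuous_pathOrbit (k : ℤ) : Continuous (pathOrbit k : A → C(PathInterval, A)) := by
  refine ContinuousMap.continuous_of_continuous_uncurry _ ?_
  change Continuous fun p : A × PathInterval => phase k p.2 • p.1
  fun_prop

theorem pathOrbit_add (k : ℤ) (a b : A) :
    pathOrbit k (a + b) = pathOrbit k a + pathOrbit k b := by ext t; simp

theorem pathOrbit_smul (k : ℤ) (c : ℂ) (a : A) :
    pathOrbit k (c • a) = c • pathOrbit k a := by ext t; exact smul_comm _ _ _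

theorem norm_integral_path_le (f : C(PathInterval, A)) :
    ‖∫ t in (-1 : ℝ)..1, f (Set.projIcc (-1) 1 (by norm_num) t)‖ ≤ 2 * ‖f‖ := by
  refine (intervalIntegral.norm_integral_le_of_norm_le_const (C := ‖f‖)
    fun t _ => f.norm_coe_le_norm _).trans (le_of_eq ?_)
  norm_num [mul_comm]

/-- Integration over `[-1, 1]`. -/
def pathIntegral : C(PathInterval, A) →L[ℂ] A :=
  LinearMap.mkContinuous
    { toFun := fun f => ∫ t in (-1 : ℝ)..1, f (Set.projIcc (-1) 1 (by norm_num) t)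
      map_add' := fun f g => intervalIntegral.integral_add
        (Continuous.intervalIntegrable (by fun_prop) _ _)
        (Continuous.intervalIntegrable (by fun_prop) _ _)
      map_smul' := fun c f => intervalIntegral.integral_smul c _ } 2 norm_integral_path_le

theorem norm_pathIntegral_le (f : C(PathInterval, A)) : ‖pathIntegral f‖ ≤ 2 * ‖f‖ :=
  norm_integral_path_le f

theorem pathIntegral_pathOrbit (k : ℤ) (a : A) :
    pathIntegral (pathOrbit k a) = (∫ t in (-1 : ℝ)..1, phase k t) • a := by
  change ∫ t in (-1 : ℝ)..1, phase k (Set.projIcc (-1 : ℝ) 1 (by norm_num) t : ℝ) • a = _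
  rw [← intervalIntegral.integral_smul_const]
  refine intervalIntegral.integral_congr fun t ht => ?_
  rw [Set.uIcc_of_le (by norm_num)] at ht
  simp only [Set.projIcc_of_mem _ ht]

theorem integral_phase_zero : ∫ t in (-1 : ℝ)..1, phase 0 t = 2 := by
  simp only [phase_zero]; norm_num

/-- For k = 2m the phase runs through |m| whole periods on an interval of length 2. -/
theorem integral_phase_even {k : ℤ} (hk : Even k) (h0 : k ≠ 0) :
    ∫ t in (-1 : ℝ)..1, phase k t = 0 := by
  obtain ⟨m, rfl⟩ := hk
  have hc : (((m + m : ℤ) : ℂ) * (Real.pi * Complex.I / 2)) ≠ 0 :=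
    mul_ne_zero (by exact_mod_cast h0)
      (div_ne_zero (mul_ne_zero (by exact_mod_cast Real.pi_ne_zero) Complex.I_ne_zero) two_ne_zero)
  have := integral_exp_mul_complex (a := -1) (b := 1) hc
  unfold phase
  rw [this, div_eq_zero_iff]
  left
  rw [sub_eq_zero, Complex.exp_eq_exp_iff_exists_int]
  exact ⟨m, by push_cast; ring⟩

end PathOrbit

/-! ### Coordinates of the crossed product and its dual circle action. -/

namespace CrossedProduct

variable {A : Type u} [CStarAlgebra A] {σ : A ≃⋆ₐ[ℂ] A}

instance : CStarAlgebra (Ambient σ) where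

instance : IsClosed (carrier σ : Set (Ambient σ)) := StarSubalgebra.isClosed_topologicalClosure _

/-- The representation of the ambient algebra given by a covariant pair. -/
def coord (p : CovariantPair σ) : Ambient σ →⋆ₐ[ℂ] p.C where
  toFun x := x p
  map_one' := rfl
  map_mul' _ _ := rfl
  map_zero' := rfl
  map_add' _ _ := rfl
  commutes' _ := rfl
  map_star' _ := rfl

theorem continuous_coord (p : CovariantPair σ) : Continuous (coord p) :=
  AddMonoidHomClass.continuous_of_bound (coord p) 1
    fun x => by simpa using! lp.norm_apply_le_norm ENNReal.top_ne_zero x p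

/-- The covariant pair on the circle with the unitary rotated by the phase. -/
@[reducible]
def rotate (p : CovariantPair σ) : CovariantPair σ where
  C := C(UnitAddCircle, p.C)
  φ := ContinuousMap.constStarHom.comp p.φ
  V := ⟨gaugeOrbit 1 (p.V : p.C), by
    rw [Unitary.mem_iff, star_gaugeOrbit, gaugeOrbit_mul, gaugeOrbit_mul]
    simp [gaugeOrbit_zero_one]⟩
  covariant a := by
    ext t
    have h : fourier 1 t * (starRingEnd ℂ) (fourier 1 t) = 1 := by
      rw [← fourier_neg, ← fourier_add]; simp
    have : (fourier 1 t • (p.V : p.C)) * p.φ a * star (fourier 1 t • (p.V : p.C))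
        = p.φ (σ a) := by
      rw [star_smul, smul_mul_assoc, smul_mul_smul_comm, p.covariant]
      rw [← starRingEnd_apply, h, one_smul]
    exact this

/-- The coordinate at the rotated pair. -/
def coordRotate (p : CovariantPair σ) : Ambient σ →⋆ₐ[ℂ] C(UnitAddCircle, p.C) := coord (rotate p)

theorem continuous_coordRotate (p : CovariantPair σ) : Continuous (coordRotate p) :=
  continuous_coord (rotate p)

theorem coordRotate_base (p : CovariantPair σ) (a : A) :
    coordRotate p (base σ a) = gaugeOrbit 0 (p.φ a) := by
  ext t
  rw [gaugeOrbit_apply, fourier_zero, one_smul]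
  rfl

theorem coordRotate_unitaryElt (p : CovariantPair σ) :
    coordRotate p (unitaryElt σ) = gaugeOrbit 1 (p.V : p.C) := rfl

theorem carrier_induction_closed {P : Ambient σ → Prop} (hc : IsClosed {x | P x})
    (h : ∀ x ∈ StarAlgebra.adjoin ℂ (Set.range (base σ) ∪ {unitaryElt σ}), P x)
    {x : Ambient σ} (hx : x ∈ carrier σ) : P x :=
  hc.closure_subset_iff.2 h hx

/-- In the ambient product the coordinates at p and at its rotation are independent. They are tied
together only on the algebra generated by the universal pair. -/
theorem coordRotate_apply_zero (p : CovariantPair σ) {x : Ambient σ} (hx : x ∈ carrier σ) :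
    coordRotate p x 0 = coord p x := by
  have hc : Continuous fun x => coordRotate p x 0 :=
    (by fun_prop : Continuous fun f : C(UnitAddCircle, p.C) => f 0).comp (continuous_coordRotate p)
  refine carrier_induction_closed (isClosed_eq hc (continuous_coord p)) (fun y hy => ?_) hx
  let ψ : Ambient σ →⋆ₐ[ℂ] p.C :=
    (ContinuousMap.evalStarHom (0 : UnitAddCircle)).comp (coordRotate p)
  have : StarAlgebra.adjoin ℂ (Set.range (base σ) ∪ {unitaryElt σ}) ≤
      StarAlgHom.equalizer ψ (coord p) := by
    refine StarAlgebra.adjoin_le ?_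
    rintro _ (⟨a, rfl⟩ | rfl)
    · change coordRotate p (base σ a) 0 = p.φ a
      rw [coordRotate_base, gaugeOrbit_apply_zero]
    · change coordRotate p (unitaryElt σ) 0 = p.V
      rw [coordRotate_unitaryElt, gaugeOrbit_apply_zero]
  exact this hy

end CrossedProduct

/-! ### Faithfulness of the path representation. -/

/-- A faithful copy of `A` in the fixed points of `σ`, together with a self-adjoint unitary negated
by `σ` and implementing `σ` on the copy. -/
structure DualPair {A : Type u} [CStarAlgebra A] (σ : A ≃⋆ₐ[ℂ] A) where
  φ : A →⋆ₐ[ℂ] A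
  W : unitary A
  injective : Function.Injective φ
  fixed : ∀ a, σ (φ a) = φ a
  covariant : ∀ a, (W : A) * φ a * star (W : A) = φ (σ a)
  selfAdjoint : star (W : A) = W
  negated : σ (W : A) = -W

section Monomials

variable {A C : Type*} [CStarAlgebra A] [CStarAlgebra C] {σ : A ≃⋆ₐ[ℂ] A} (φ : A →⋆ₐ[ℂ] C)
  (V : unitary C)

theorem unitary_mul_monomial (h : ∀ a, (V : C) * φ a * star (V : C) = φ (σ a)) (a : A) (k : ℤ) :
    (V : C) * (φ a * ((V ^ k : unitary C) : C)) = φ (σ a) * ((V ^ (1 + k) : unitary C) : C) := by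
  rw [← h, zpow_one_add, Submonoid.coe_mul]
  simp only [mul_assoc]
  rw [← mul_assoc (star (V : C)) V, Unitary.coe_star_mul_self, one_mul]

theorem star_unitary_mul_monomial (h : ∀ a, (V : C) * φ a * star (V : C) = φ (σ a)) (a : A)
    (k : ℤ) : star (V : C) * (φ a * ((V ^ k : unitary C) : C)) =
      φ (σ.symm a) * ((V ^ (-1 + k) : unitary C) : C) := by
  have h1 := h (σ.symm a)
  rw [StarAlgEquiv.apply_symm_apply] at h1
  rw [← h1, zpow_add, Submonoid.coe_mul, zpow_neg_one, ← Unitary.star_eq_inv, Unitary.coe_star]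
  simp only [mul_assoc]
  rw [← mul_assoc (star (V : C)) V, Unitary.coe_star_mul_self, one_mul]

end Monomials

namespace DualPair

open CrossedProduct

variable {A : Type u} [CStarAlgebra A] {σ : A ≃⋆ₐ[ℂ] A} (d : DualPair σ)

theorem map_W_zpow (k : ℤ) : σ ((d.W ^ k : unitary A) : A) =
    (-1 : ℂ) ^ k • ((d.W ^ k : unitary A) : A) := by
  let τ : unitary A →* unitary A := MonoidHom.mk' (fun u => ⟨σ u, Unitary.map_mem σ u.2⟩)
    fun u v => Subtype.ext (map_mul σ (u : A) v)
  have hσ : τ d.W = -d.W := Subtype.ext d.negated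
  have h := map_zpow τ d.W k
  rw [hσ] at h
  have h2 : σ ((d.W ^ k : unitary A) : A) = (((-d.W) ^ k : unitary A) : A) :=
    congrArg Subtype.val h
  rw [h2]
  rcases Int.even_or_odd k with hk | hk
  · rw [hk.neg_zpow, hk.neg_one_zpow, one_smul]
  · rw [hk.neg_zpow, hk.neg_one_zpow, neg_one_smul]; rfl

/-- The average of a path over `[-1, 1]` and over `σ`. -/
def pathMean (σ : A ≃⋆ₐ[ℂ] A) (f : C(PathInterval, A)) : A :=
  (4 : ℂ)⁻¹ • (pathIntegral f + σ (pathIntegral f))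

theorem pathMean_add (f g : C(PathInterval, A)) :
    pathMean σ (f + g) = pathMean σ f + pathMean σ g := by
  simp only [pathMean, map_add, ← smul_add]; congr 1; abel

theorem pathMean_smul (c : ℂ) (f : C(PathInterval, A)) :
    pathMean σ (c • f) = c • pathMean σ f := by
  simp only [pathMean, map_smul, ← smul_add]; rw [smul_comm]

theorem norm_pathMean_le (f : C(PathInterval, A)) : ‖pathMean σ f‖ ≤ ‖f‖ := by
  have h1 := norm_pathIntegral_le f
  have h2 : ‖σ (pathIntegral f)‖ = ‖pathIntegral f‖ := StarAlgEquiv.norm_map σ _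
  have h3 := norm_add_le (pathIntegral f) (σ (pathIntegral f))
  rw [pathMean, norm_smul]
  norm_num
  linarith

/-- Averaging over σ kills odd k, since σ(Wᵏ) = (−1)ᵏWᵏ; integration kills even k ≠ 0. For k = 0 the
factor 1/4 cancels the length 2 and the two summands. -/
theorem pathMean_pathOrbit (k : ℤ) (a : A) :
    pathMean σ (pathOrbit k (d.φ a * ((d.W ^ k : unitary A) : A))) =
      if k = 0 then d.φ a else 0 := by
  rw [pathMean, pathIntegral_pathOrbit, map_smul, map_mul, d.fixed, d.map_W_zpow, mul_smul_comm]
  rcases eq_or_ne k 0 with rfl | hk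
  · rw [integral_phase_zero, if_pos rfl]
    simp only [zpow_zero, one_smul, OneMemClass.coe_one, mul_one]
    rw [← add_smul, smul_smul]
    norm_num
  rw [if_neg hk]
  rcases Int.even_or_odd k with he | ho
  · rw [integral_phase_even he hk]; simp
  · rw [ho.neg_one_zpow]; simp

variable [Nontrivial A]

/-- The covariant pair on paths given by constants and `t ↦ exp (iπt/2) W`. -/
@[reducible]
def toCovariantPair : CovariantPair σ where
  C := C(PathInterval, A)
  φ := ContinuousMap.constStarHom.comp d.φ
  V := ⟨pathOrbit 1 (d.W : A), by
    rw [Unitary.mem_iff, star_pathOrbit, pathOrbit_mul, pathOrbit_mul]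
    simp [pathOrbit_zero]⟩
  covariant a := by
    change pathOrbit 1 (d.W : A) * ContinuousMap.constStarHom (d.φ a) * star (pathOrbit 1 (d.W : A))
      = ContinuousMap.constStarHom (d.φ (σ a))
    rw [← pathOrbit_zero, ← pathOrbit_zero, star_pathOrbit, pathOrbit_mul, pathOrbit_mul,
      d.covariant]
    simp

/-- The representation of the ambient algebra on paths. -/
def pathHom : Ambient σ →⋆ₐ[ℂ] C(PathInterval, A) := coord d.toCovariantPair

theorem pathHom_base (a : A) : d.pathHom (base σ a) = pathOrbit 0 (d.φ a) := by
  rw [pathOrbit_zero]; rfl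

theorem pathHom_unitaryElt : d.pathHom (unitaryElt σ) = pathOrbit 1 (d.W : A) := rfl

theorem continuous_pathHom : Continuous d.pathHom := continuous_coord d.toCovariantPair

/-- The same k and a serve both representations, which makes their means comparable. -/
theorem monomial_of_mem_closure (p : CovariantPair σ) {x : Ambient σ}
    (hx : x ∈ Submonoid.closure ((Set.range (base σ) ∪ {unitaryElt σ}) ∪
      star (Set.range (base σ) ∪ {unitaryElt σ}))) :
    ∃ (k : ℤ) (a : A),
      coordRotate p x = gaugeOrbit k (p.φ a * ((p.V ^ k : unitary p.C) : p.C)) ∧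
      d.pathHom x = pathOrbit k (d.φ a * ((d.W ^ k : unitary A) : A)) := by
  induction hx using Submonoid.closure_induction_left with
  | one => exact ⟨0, 1, by simp [gaugeOrbit_zero_one], by simp [pathOrbit_zero]⟩
  | mul_left x hx y hy ih =>
    obtain ⟨k, a, h1, h2⟩ := ih
    have hb : ∀ b : A, x = base σ b → ∃ (k : ℤ) (a : A),
        coordRotate p (x * y) = gaugeOrbit k (p.φ a * ((p.V ^ k : unitary p.C) : p.C)) ∧
        d.pathHom (x * y) = pathOrbit k (d.φ a * ((d.W ^ k : unitary A) : A)) := by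
      rintro b rfl
      refine ⟨k, b * a, ?_, ?_⟩
      · rw [map_mul, h1, coordRotate_base, gaugeOrbit_mul, zero_add, map_mul, mul_assoc]
      · rw [map_mul, h2, pathHom_base, pathOrbit_mul, zero_add, map_mul, mul_assoc]
    rcases hx with (⟨b, rfl⟩ | rfl) | (⟨b, hb'⟩ | hx)
    · exact hb b rfl
    · refine ⟨1 + k, σ a, ?_, ?_⟩
      · rw [map_mul, h1, coordRotate_unitaryElt, gaugeOrbit_mul,
          unitary_mul_monomial p.φ p.V p.covariant]
      · rw [map_mul, h2, pathHom_unitaryElt, pathOrbit_mul,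
          unitary_mul_monomial d.φ d.W d.covariant]
    · exact hb (star b) (by rw [map_star, hb', star_star])
    · obtain rfl : x = star (unitaryElt σ) :=
        (star_eq_iff_star_eq.1 (Set.mem_singleton_iff.1 hx)).symm
      refine ⟨-1 + k, σ.symm a, ?_, ?_⟩
      · rw [map_mul, h1, map_star, coordRotate_unitaryElt, star_gaugeOrbit, gaugeOrbit_mul,
          star_unitary_mul_monomial p.φ p.V p.covariant]
      · rw [map_mul, h2, map_star, pathHom_unitaryElt, star_pathOrbit, pathOrbit_mul,
          star_unitary_mul_monomial d.φ d.W d.covariant]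

theorem exists_mean {p : CovariantPair σ} {x : Ambient σ}
    (hx : x ∈ StarAlgebra.adjoin ℂ (Set.range (base σ) ∪ {unitaryElt σ})) :
    ∃ a : A, circleMean (coordRotate p x) = p.φ a ∧ pathMean σ (d.pathHom x) = d.φ a := by
  rw [← StarSubalgebra.mem_toSubalgebra, ← Subalgebra.mem_toSubmodule,
    StarAlgebra.adjoin_eq_span] at hx
  induction hx using Submodule.span_induction with
  | mem x hx =>
    obtain ⟨k, a, h1, h2⟩ := d.monomial_of_mem_closure p hx
    rw [h1, h2, circleMean_gaugeOrbit, d.pathMean_pathOrbit]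
    split_ifs with hk
    · exact ⟨a, by simp [hk], rfl⟩
    · exact ⟨0, by simp, by simp⟩
  | zero => exact ⟨0, by simp, by simp [pathMean]⟩
  | add x y _ _ hx hy =>
    obtain ⟨a, ha, ha'⟩ := hx
    obtain ⟨b, hb, hb'⟩ := hy
    exact ⟨a + b, by simp only [map_add, ha, hb], by simp only [map_add, pathMean_add, ha', hb']⟩
  | smul c x _ hx =>
    obtain ⟨a, ha, ha'⟩ := hx
    exact ⟨c • a, by simp only [map_smul, ha], by simp only [map_smul, pathMean_smul, ha']⟩

/-- Both means see the same a: `p.φ` is contractive, `d.φ` isometric and `pathMean` contractive. -/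
theorem norm_circleMean_le (p : CovariantPair σ) {x : Ambient σ} (hx : x ∈ carrier σ) :
    ‖circleMean (coordRotate p x)‖ ≤ ‖d.pathHom x‖ := by
  have h1 := continuous_coordRotate p
  have h2 := d.continuous_pathHom
  refine carrier_induction_closed (P := fun x => ‖circleMean (coordRotate p x)‖ ≤ ‖d.pathHom x‖)
    (isClosed_le (by fun_prop) (by fun_prop)) (fun y hy => ?_) hx
  obtain ⟨a, ha, ha'⟩ := d.exists_mean (p := p) hy
  rw [ha]
  calc ‖p.φ a‖ ≤ ‖a‖ := NonUnitalStarAlgHom.norm_apply_le p.φ a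
    _ = ‖d.φ a‖ := (NonUnitalStarAlgHom.norm_map d.φ d.injective a).symm
    _ = ‖pathMean σ (d.pathHom y)‖ := by rw [ha']
    _ ≤ _ := norm_pathMean_le _

/-- The crossed product is faithfully represented on paths. -/
theorem pathHom_injective : Function.Injective (d.pathHom.comp (carrier σ).subtype) := by
  refine (injective_iff_map_eq_zero _).2 fun x hx => ?_
  have hx0 : d.pathHom (x : Ambient σ) = 0 := hx
  refine Subtype.ext (lp.ext (funext fun p => ?_))
  -- Applied to x*x, the estimate reduces vanishing of every coordinate to faithfulness of the
  -- circle mean.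
  have h := d.norm_circleMean_le p (mul_mem (star_mem x.2) x.2)
  rw [map_mul (coordRotate p), map_star, map_mul d.pathHom, hx0, mul_zero, norm_zero,
    norm_le_zero_iff] at h
  have h0 := eq_zero_of_circleMean_star_mul_self _ h
  have h1 := coordRotate_apply_zero p x.2
  rw [h0] at h1
  exact h1.symm

end DualPair

/-! ### Generating the twisted paths. -/

namespace PathInterval

/-- The left endpoint. -/
abbrev left : PathInterval := ⟨-1, by norm_num⟩

/-- The right endpoint. -/
abbrev right : PathInterval := ⟨1, by norm_num⟩

end PathInterval

section PathAlgebra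

variable {A : Type u} [CStarAlgebra A]

/-- The path `t ↦ h(t) a`. -/
def scalarPath (h : C(PathInterval, ℂ)) (a : A) : C(PathInterval, A) :=
  ⟨fun t => h t • a, by fun_prop⟩

@[simp]
theorem scalarPath_apply (h : C(PathInterval, ℂ)) (a : A) (t : PathInterval) :
    scalarPath h a t = h t • a := rfl

theorem exists_circle_function (h : C(PathInterval, ℂ))
    (h1 : h PathInterval.left = h PathInterval.right) :
    ∃ G : C(AddCircle (2 : ℝ), ℂ), ∀ t : PathInterval, G ((t : ℝ) : AddCircle (2 : ℝ)) = h t := by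
  have : Fact ((0 : ℝ) < 2) := ⟨two_pos⟩
  set f : ℝ → ℂ := fun t => h (Set.projIcc (-1) 1 (by norm_num) t) with hf
  have hfc : Continuous f := by fun_prop
  have hft : ∀ t : PathInterval, f t = h t := fun t => by simp [hf]
  have hper : f (-1) = f (-1 + 2) := by
    have e1 := hft PathInterval.left
    have e2 := hft PathInterval.right
    rw [show (-1 : ℝ) + 2 = 1 by norm_num]
    exact e1.trans (h1.trans e2.symm)
  refine ⟨⟨liftIco 2 (-1) f, liftIco_continuous hper hfc.continuousOn⟩, fun t => ?_⟩
  rw [ContinuousMap.coe_mk, ← hft]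
  rcases eq_or_lt_of_le t.2.2 with ht | ht
  · have e : ((t : ℝ) : AddCircle (2 : ℝ)) = ((-1 : ℝ) : AddCircle (2 : ℝ)) := by
      rw [ht]
      exact (congrArg _ (by norm_num : (1 : ℝ) = -1 + 2)).trans (coe_add_period 2 (-1))
    rw [e, liftIco_coe_apply (by norm_num), hper, ht]
    norm_num
  · exact liftIco_coe_apply ⟨t.2.1, by linarith⟩

theorem fourier_two_eq_phase (n : ℤ) (t : ℝ) :
    fourier n (t : AddCircle (2 : ℝ)) = phase (2 * n) t := by
  rw [fourier_coe_apply, phase]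
  congr 1
  push_cast
  ring

/-- The scalar paths given by functions on the circle. -/
def circlePath : C(AddCircle (2 : ℝ), ℂ) →L[ℂ] C(PathInterval, A) where
  toFun G := ⟨fun t => G ((t : ℝ) : AddCircle (2 : ℝ)) • (1 : A), by fun_prop⟩
  map_add' G H := by ext t; exact add_smul _ _ _
  map_smul' c G := by ext t; exact mul_smul _ _ _
  cont := by
    refine ContinuousMap.continuous_of_continuous_uncurry _ ?_
    change Continuous fun p : C(AddCircle (2 : ℝ), ℂ) × PathInterval =>
      p.1 ((p.2 : ℝ) : AddCircle (2 : ℝ)) • (1 : A)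
    fun_prop

variable {R : StarSubalgebra ℂ C(PathInterval, A)}

theorem pathOrbit_even_mem (h2 : pathOrbit 2 (1 : A) ∈ R) (n : ℤ) :
    pathOrbit (2 * n) (1 : A) ∈ R := by
  have hpow : ∀ m : ℕ, pathOrbit (2 * m) (1 : A) ∈ R := by
    intro m
    induction m with
    | zero => simp [pathOrbit_zero]
    | succ m ih =>
      have := mul_mem ih h2
      rw [pathOrbit_mul, one_mul] at this
      convert this using 2
      push_cast; ring
  obtain ⟨m, rfl | rfl⟩ := n.eq_nat_or_neg
  · exact hpow m
  · have := star_mem (hpow m)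
    rw [star_pathOrbit, star_one] at this
    convert this using 2
    ring

theorem circlePath_mem (hR : IsClosed (R : Set C(PathInterval, A)))
    (h2 : pathOrbit 2 (1 : A) ∈ R) (G : C(AddCircle (2 : ℝ), ℂ)) : circlePath G ∈ R := by
  have : Fact ((0 : ℝ) < 2) := ⟨two_pos⟩
  set M : Submodule ℂ C(AddCircle (2 : ℝ), ℂ) :=
    (Subalgebra.toSubmodule R.toSubalgebra).comap (circlePath (A := A)).toLinearMap
  have hM : IsClosed (M : Set C(AddCircle (2 : ℝ), ℂ)) :=
    hR.preimage (circlePath (A := A)).continuous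
  have hle : (Submodule.span ℂ (Set.range (fourier (T := 2)))).topologicalClosure ≤ M := by
    refine Submodule.topologicalClosure_minimal _ (Submodule.span_le.2 ?_) hM
    rintro _ ⟨n, rfl⟩
    have : circlePath (fourier n) = pathOrbit (2 * n) (1 : A) := by
      ext t
      change fourier n ((t : ℝ) : AddCircle (2 : ℝ)) • (1 : A) = _
      rw [fourier_two_eq_phase, pathOrbit_apply]
    change circlePath (fourier n) ∈ R
    rw [this]
    exact pathOrbit_even_mem h2 n
  rw [span_fourier_closure_eq_top] at hle
  exact hle (Submodule.mem_top : G ∈ ⊤)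

theorem scalarPath_one_mem (hR : IsClosed (R : Set C(PathInterval, A)))
    (h2 : pathOrbit 2 (1 : A) ∈ R) {h : C(PathInterval, ℂ)}
    (h1 : h PathInterval.left = h PathInterval.right) : scalarPath h (1 : A) ∈ R := by
  obtain ⟨G, hG⟩ := exists_circle_function h h1
  have : scalarPath h (1 : A) = circlePath G := by
    ext t
    rw [scalarPath_apply, ← hG]
    rfl
  rw [this]
  exact circlePath_mem hR h2 G

/-- Bernstein approximants of f are sums of scalar functions times values of f. The two extreme
terms drop out because f vanishes at the ends; the other basis functions vanish there themselves. -/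
theorem mem_of_scalarPath_mem (hR : IsClosed (R : Set C(PathInterval, A)))
    {f : C(PathInterval, A)} (hl : f PathInterval.left = 0) (hr : f PathInterval.right = 0)
    (h : ∀ g : C(PathInterval, ℂ), g PathInterval.left = 0 → g PathInterval.right = 0 →
      ∀ t, scalarPath g (f t) ∈ R) : f ∈ R := by
  let α : C(unitInterval, PathInterval) :=
    ⟨fun s => ⟨2 * s - 1, by constructor <;> linarith [s.2.1, s.2.2]⟩, by fun_prop⟩
  let β : C(PathInterval, unitInterval) :=
    ⟨fun t => ⟨(t + 1) / 2, by constructor <;> linarith [t.2.1, t.2.2]⟩, by fun_prop⟩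
  have hαβ : ∀ t, α (β t) = t := fun t =>
    Subtype.ext (by simp only [α, β, ContinuousMap.coe_mk]; ring)
  have hα0 : α 0 = PathInterval.left := Subtype.ext (by simp [α])
  have hα1 : α 1 = PathInterval.right := Subtype.ext (by norm_num [α])
  have hβ0 : β PathInterval.left = 0 := Subtype.ext (by simp [β])
  have hβ1 : β PathInterval.right = 1 := Subtype.ext (by norm_num [β])
  have hlim : Filter.Tendsto (fun n => (bernsteinApproximation n (f.comp α)).comp β)
      Filter.atTop (nhds f) := by
    have h1 := ((ContinuousMap.continuous_precomp β).tendsto (f.comp α)).comp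
      (bernsteinApproximation_uniform (f.comp α))
    have h2 : (f.comp α).comp β = f := by ext t; simp [hαβ]
    rwa [h2] at h1
  refine hR.mem_of_tendsto hlim (Filter.eventually_atTop.2 ⟨1, fun n hn => ?_⟩)
  have hn0 : n ≠ 0 := by omega
  have hsum : (bernsteinApproximation n (f.comp α)).comp β =
      ∑ k : Fin (n + 1), scalarPath
        ⟨fun t => ((bernstein n k (β t) : ℝ) : ℂ), by fun_prop⟩ (f (α (bernstein.z k))) := by
    ext t
    rw [ContinuousMap.comp_apply, bernsteinApproximation.apply, ContinuousMap.sum_apply]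
    refine Finset.sum_congr rfl fun k _ => ?_
    simp
  rw [hsum]
  refine sum_mem fun k _ => ?_
  by_cases hk0 : k = 0
  · have : f (α (bernstein.z k)) = 0 := by rw [hk0, bernstein.z_zero, hα0, hl]
    rw [this]
    convert zero_mem R
    ext t; simp
  by_cases hkn : k = Fin.last n
  · have : f (α (bernstein.z k)) = 0 := by rw [hkn, bernstein.z_last hn0, hα1, hr]
    rw [this]
    convert zero_mem R
    ext t; simp
  have hk0' : (k : ℕ) ≠ 0 := fun h => hk0 (Fin.ext h)
  have hkn' : n - (k : ℕ) ≠ 0 := by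
    have : (k : ℕ) ≠ n := fun h => hkn (Fin.ext h)
    have := k.2
    omega
  refine h _ ?_ ?_ _
  · simp [hβ0, bernstein_apply, hk0']
  · simp [hβ1, bernstein_apply, hkn']

theorem pathOrbit_one_mul_one_mul_neg_two (a b : A) :
    pathOrbit 1 a * pathOrbit 1 b * pathOrbit (-2) 1 = pathOrbit 0 (a * b) := by
  rw [pathOrbit_mul, pathOrbit_mul, mul_one, show (1 + 1 + -2 : ℤ) = 0 by norm_num]

theorem pathOrbit_even_part_mul (a b a' b' : A) :
    pathOrbit 0 (a * b + a' * b') = (2 : ℂ)⁻¹ •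
      (pathOrbit 0 (a + a') * pathOrbit 0 (b + b') +
        pathOrbit 1 (a - a') * pathOrbit 1 (b - b') * pathOrbit (-2) 1) := by
  rw [pathOrbit_one_mul_one_mul_neg_two, pathOrbit_mul, add_zero, ← pathOrbit_add,
    ← pathOrbit_smul]
  congr 1
  rw [eq_inv_smul_iff₀ two_ne_zero, two_smul]
  noncomm_ring

theorem pathOrbit_odd_part_mul (a b a' b' : A) :
    pathOrbit 1 (a * b - a' * b') = (2 : ℂ)⁻¹ •
      (pathOrbit 0 (a + a') * pathOrbit 1 (b - b') +
        pathOrbit 1 (a - a') * pathOrbit 0 (b + b')) := by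
  rw [pathOrbit_mul, pathOrbit_mul, add_zero, zero_add, ← pathOrbit_add, ← pathOrbit_smul]
  congr 1
  rw [eq_inv_smul_iff₀ two_ne_zero, two_smul]
  noncomm_ring

variable {σ : A ≃⋆ₐ[ℂ] A}

/-- The `σ`-even and `σ`-odd parts of `a` give paths in `R`. -/
def HasPathParts (R : StarSubalgebra ℂ C(PathInterval, A)) (σ : A ≃⋆ₐ[ℂ] A) (a : A) : Prop :=
  pathOrbit 0 (a + σ a) ∈ R ∧ pathOrbit 1 (a - σ a) ∈ R

namespace HasPathParts

theorem mul (h2 : pathOrbit 2 (1 : A) ∈ R) {a b : A} (ha : HasPathParts R σ a)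
    (hb : HasPathParts R σ b) : HasPathParts R σ (a * b) := by
  have h2' := star_mem h2
  rw [star_pathOrbit, star_one] at h2'
  have m1 := mul_mem ha.1 hb.1
  have m2 := mul_mem (mul_mem ha.2 hb.2) h2'
  have m3 := mul_mem ha.1 hb.2
  have m4 := mul_mem ha.2 hb.1
  have n1 := R.smul_mem (add_mem m1 m2) (2 : ℂ)⁻¹
  have n2 := R.smul_mem (add_mem m3 m4) (2 : ℂ)⁻¹
  rw [← pathOrbit_even_part_mul, ← map_mul] at n1
  rw [← pathOrbit_odd_part_mul, ← map_mul] at n2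
  exact ⟨n1, n2⟩

theorem add {a b : A} (ha : HasPathParts R σ a) (hb : HasPathParts R σ b) :
    HasPathParts R σ (a + b) := by
  have n1 := add_mem ha.1 hb.1
  have n2 := add_mem ha.2 hb.2
  rw [← pathOrbit_add, add_add_add_comm, ← map_add] at n1
  rw [← pathOrbit_add, ← add_sub_add_comm, ← map_add] at n2
  exact ⟨n1, n2⟩

theorem of_scalar (r : ℂ) : HasPathParts R σ (algebraMap ℂ A r) := by
  have h1 : σ (algebraMap ℂ A r) = algebraMap ℂ A r := AlgHomClass.commutes σ r
  rw [HasPathParts, h1, sub_self, ← map_add, pathOrbit_zero, AlgHomClass.commutes]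
  refine ⟨R.algebraMap_mem _, ?_⟩
  have h0 : pathOrbit 1 (0 : A) = 0 := by ext t; simp
  rw [h0]
  exact zero_mem R

theorem star_elt (h2 : pathOrbit 2 (1 : A) ∈ R) {a : A} (ha : HasPathParts R σ a) :
    HasPathParts R σ (star a) := by
  have n1 := star_mem ha.1
  have n2 := mul_mem (star_mem ha.2) h2
  rw [star_pathOrbit, neg_zero, star_add, ← map_star] at n1
  rw [star_pathOrbit, pathOrbit_mul, mul_one, star_sub, ← map_star,
    show (-1 + 2 : ℤ) = 1 by norm_num] at n2
  exact ⟨n1, n2⟩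

end HasPathParts

/-- The subalgebra of elements whose `σ`-even and `σ`-odd parts give paths in `R`. -/
def gradedPart (R : StarSubalgebra ℂ C(PathInterval, A)) (σ : A ≃⋆ₐ[ℂ] A)
    (h2 : pathOrbit 2 (1 : A) ∈ R) : StarSubalgebra ℂ A where
  carrier := {a | HasPathParts R σ a}
  mul_mem' ha hb := HasPathParts.mul h2 ha hb
  add_mem' ha hb := HasPathParts.add ha hb
  algebraMap_mem' r := HasPathParts.of_scalar r
  star_mem' ha := HasPathParts.star_elt h2 ha

theorem isClosed_gradedPart (hR : IsClosed (R : Set C(PathInterval, A)))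
    (h2 : pathOrbit 2 (1 : A) ∈ R) : IsClosed (gradedPart R σ h2 : Set A) := by
  have hσ : Continuous σ := (StarAlgEquiv.isometry σ).continuous
  have c0 := continuous_pathOrbit (A := A) 0
  have c1 := continuous_pathOrbit (A := A) 1
  exact (hR.preimage (c0.comp (continuous_id.add hσ))).inter
    (hR.preimage (c1.comp (continuous_id.sub hσ)))

theorem phase_one_right : phase 1 1 = Complex.I := by
  rw [phase]
  convert Complex.exp_pi_div_two_mul_I using 2
  push_cast; ring

theorem phase_neg_one_right : phase (-1) 1 = -Complex.I := by
  rw [← star_phase, phase_one_right]; simp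

theorem phase_one_left : phase 1 (-1) = -Complex.I := by
  rw [← phase_neg_one_right, phase, phase]
  congr 1; push_cast; ring

/-- Split f into σ-even and σ-odd parts p and q. The twist says p(−1) = p(1) and q(−1) = −q(1), so
each agrees at both ends with a path already in R; the remainder vanishes at the ends. -/
theorem twistedPaths_le (hR : IsClosed (R : Set C(PathInterval, A)))
    (h2 : pathOrbit 2 (1 : A) ∈ R) (hσ : ∀ a, σ (σ a) = a) {T : Set A}
    (hT : (StarAlgebra.adjoin ℂ T).topologicalClosure = ⊤)
    (hTR : ∀ a ∈ T, pathOrbit 0 (a + σ a) ∈ R ∧ pathOrbit 1 (a - σ a) ∈ R) :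
    twistedPaths σ ≤ R := by
  have hσc : Continuous σ := (StarAlgEquiv.isometry σ).continuous
  have hall : ∀ a, pathOrbit 0 (a + σ a) ∈ R ∧ pathOrbit 1 (a - σ a) ∈ R := by
    have h1 : (StarAlgebra.adjoin ℂ T).topologicalClosure ≤ gradedPart R σ h2 :=
      StarSubalgebra.topologicalClosure_minimal (StarAlgebra.adjoin_le hTR)
        (isClosed_gradedPart hR h2)
    intro a
    exact h1 (hT ▸ StarSubalgebra.mem_top : a ∈ (StarAlgebra.adjoin ℂ T).topologicalClosure)
  have half : ∀ a : A, (2 : ℂ)⁻¹ • (a + a) = a := fun a => by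
    rw [← two_smul ℂ a, smul_smul, inv_mul_cancel₀ two_ne_zero, one_smul]
  have heven : ∀ a, σ a = a → pathOrbit 0 a ∈ R := by
    intro a ha
    have := R.smul_mem (hall a).1 (2 : ℂ)⁻¹
    rwa [← pathOrbit_smul, ha, half] at this
  have hodd : ∀ a, σ a = -a → pathOrbit 1 a ∈ R := by
    intro a ha
    have := R.smul_mem (hall a).2 (2 : ℂ)⁻¹
    rwa [← pathOrbit_smul, ha, sub_neg_eq_add, half] at this
  intro f hf
  have hf' : f PathInterval.left = σ (f PathInterval.right) := hf
  let τ : C(A, A) := ⟨σ, hσc⟩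
  set p : C(PathInterval, A) := f + τ.comp f with hp
  set q : C(PathInterval, A) := f - τ.comp f with hq
  have hp_apply : ∀ t, p t = f t + σ (f t) := fun t => rfl
  have hq_apply : ∀ t, q t = f t - σ (f t) := fun t => rfl
  have hp_fixed : ∀ t, σ (p t) = p t := fun t => by
    rw [hp_apply, map_add, hσ, add_comm]
  have hq_neg : ∀ t, σ (q t) = -q t := fun t => by
    rw [hq_apply, map_sub, hσ, neg_sub]
  have hp_ends : p PathInterval.left = p PathInterval.right := by
    rw [hp_apply, hp_apply, hf', hσ, add_comm]
  have hq_ends : q PathInterval.left = -q PathInterval.right := by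
    rw [hq_apply, hq_apply, hf', hσ, neg_sub]
  have hpR : p ∈ R := by
    have hc : pathOrbit 0 (p PathInterval.right) ∈ R := heven _ (hp_fixed _)
    have : p - pathOrbit 0 (p PathInterval.right) ∈ R := by
      refine mem_of_scalarPath_mem hR (by simp [hp_ends]) (by simp) fun g gl gr t => ?_
      set a := (p - pathOrbit 0 (p PathInterval.right)) t with ha
      have hfix : σ a = a := by
        simp only [ha, ContinuousMap.sub_apply, pathOrbit_apply, phase_zero, one_smul, map_sub,
          hp_fixed]
      have := mul_mem (scalarPath_one_mem hR h2 (gl.trans gr.symm)) (heven a hfix)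
      convert this using 1
      ext s; simp
    simpa using add_mem this hc
  have hqR : q ∈ R := by
    -- The phase is i at 1 and −i at −1, so this c gives `pathOrbit 1 c` the end values of q.
    set c : A := (-Complex.I) • q PathInterval.right with hc_def
    have hc : pathOrbit 1 c ∈ R := hodd _ (by rw [hc_def, map_smul, hq_neg, smul_neg])
    have : q - pathOrbit 1 c ∈ R := by
      refine mem_of_scalarPath_mem hR ?_ ?_ fun g gl gr t => ?_
      · simp [hq_ends, phase_one_left, hc_def, smul_smul]
      · simp [phase_one_right, hc_def, smul_smul]
      set a := (q - pathOrbit 1 c) t with ha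
      have hneg : σ a = -a := by
        simp only [ha, hc_def, ContinuousMap.sub_apply, pathOrbit_apply, map_smul, map_sub,
          hq_neg, smul_neg]
        abel
      -- An odd a enters R only with the phase exp(iπt/2), so the scalar factor absorbs the inverse
      -- phase; vanishing ends survive.
      let g' : C(PathInterval, ℂ) := ⟨fun t => g t * phase (-1) t, by fun_prop⟩
      have hg' : g' PathInterval.left = g' PathInterval.right := by simp [g', gl, gr]
      have := mul_mem (scalarPath_one_mem hR h2 hg') (hodd a hneg)
      convert this using 1
      ext s
      have hs : phase (-1) s * phase 1 s = 1 := by rw [← phase_add]; simp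
      simp only [scalarPath_apply, ContinuousMap.mul_apply, pathOrbit_apply, g',
        ContinuousMap.coe_mk, smul_mul_smul_comm, one_mul, mul_assoc, hs, mul_one]
    simpa using add_mem this hc
  have : f = (2 : ℂ)⁻¹ • (p + q) := by
    ext t
    change f t = (2 : ℂ)⁻¹ • (f t + σ (f t) + (f t - σ (f t)))
    rw [add_add_sub_cancel, half]
  rw [this]
  exact R.smul_mem (add_mem hpR hqR) _

end PathAlgebra

/-! ### The isomorphism obtained from a dual pair. -/

namespace DualPair

open CrossedProduct

variable {A : Type u} [CStarAlgebra A] [Nontrivial A] {σ : A ≃⋆ₐ[ℂ] A} (d : DualPair σ)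

theorem pathHom_mem_twistedPaths {x : Ambient σ} (hx : x ∈ carrier σ) :
    d.pathHom x ∈ twistedPaths σ := by
  have hσc : Continuous σ := (StarAlgEquiv.isometry σ).continuous
  have hcl : IsClosed (twistedPaths σ : Set C(PathInterval, A)) :=
    isClosed_eq (f := fun f : C(PathInterval, A) => f PathInterval.left)
      (g := fun f : C(PathInterval, A) => σ (f PathInterval.right)) (by fun_prop) (by fun_prop)
  refine carrier_induction_closed (hcl.preimage d.continuous_pathHom) (fun y hy => ?_) hx
  have : StarAlgebra.adjoin ℂ (Set.range (base σ) ∪ {unitaryElt σ}) ≤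
      (twistedPaths σ).comap d.pathHom := by
    refine StarAlgebra.adjoin_le ?_
    rintro _ (⟨a, rfl⟩ | rfl)
    · change d.pathHom (base σ a) PathInterval.left = σ (d.pathHom (base σ a) PathInterval.right)
      rw [pathHom_base]
      simp [d.fixed]
    · change d.pathHom (unitaryElt σ) PathInterval.left =
        σ (d.pathHom (unitaryElt σ) PathInterval.right)
      rw [pathHom_unitaryElt]
      simp [d.negated, phase_one_left, phase_one_right]
  exact this hy

/-- The crossed product is the algebra of twisted paths. -/
theorem nonempty_starAlgEquiv (hσ : ∀ a, σ (σ a) = a) {T : Set A}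
    (hT : (StarAlgebra.adjoin ℂ T).topologicalClosure = ⊤)
    (h0 : ∀ a ∈ T, ∃ b, d.φ b = a + σ a) (h1 : ∀ a ∈ T, ∃ b, d.W * d.φ b = a - σ a) :
    Nonempty (CrossedProduct σ ≃⋆ₐ[ℂ] twistedPaths σ) := by
  set Φ := d.pathHom.comp (carrier σ).subtype with hΦ
  have hrange : (Φ.range : Set C(PathInterval, A)) = Set.range Φ := rfl
  have hcl : IsClosed (Φ.range : Set C(PathInterval, A)) := by
    rw [hrange]
    exact (NonUnitalStarAlgHom.isometry Φ d.pathHom_injective).isClosedEmbedding.isClosed_range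
  have hmem : ∀ x ∈ Set.range (base σ) ∪ {unitaryElt σ}, d.pathHom x ∈ Φ.range := fun x hx =>
    ⟨⟨x, StarSubalgebra.le_topologicalClosure _ (StarAlgebra.subset_adjoin _ _ hx)⟩, rfl⟩
  have hb : ∀ a, pathOrbit 0 (d.φ a) ∈ Φ.range := fun a => by
    rw [← pathHom_base]; exact hmem _ (Or.inl ⟨a, rfl⟩)
  have hu : pathOrbit 1 (d.W : A) ∈ Φ.range := by
    rw [← pathHom_unitaryElt]; exact hmem _ (Or.inr rfl)
  have hWW : (d.W : A) * d.W = 1 := by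
    have := Unitary.coe_star_mul_self d.W
    rwa [d.selfAdjoint] at this
  have h2 : pathOrbit 2 (1 : A) ∈ Φ.range := by
    have := mul_mem hu hu
    rwa [pathOrbit_mul, hWW] at this
  have hle : twistedPaths σ ≤ Φ.range := by
    refine twistedPaths_le hcl h2 hσ hT fun a ha => ⟨?_, ?_⟩
    · obtain ⟨b, hb'⟩ := h0 a ha
      rw [← hb']; exact hb b
    · obtain ⟨b, hb'⟩ := h1 a ha
      have := mul_mem hu (hb b)
      rwa [pathOrbit_mul, hb'] at this
  let Ψ : CrossedProduct σ →⋆ₐ[ℂ] twistedPaths σ :=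
    Φ.codRestrict (twistedPaths σ) fun x => d.pathHom_mem_twistedPaths x.2
  refine ⟨StarAlgEquiv.ofBijective Ψ ⟨fun x y h => ?_, fun f => ?_⟩⟩
  · exact d.pathHom_injective (congrArg Subtype.val h)
  · obtain ⟨x, hx⟩ := hle f.2
    exact ⟨x, Subtype.ext hx⟩

end DualPair

/-! ### The dual pair of the flip. -/

section Flip

variable {A : Type u} [CStarAlgebra A] [Nontrivial A] {S₁ S₂ : A}

theorem IsCuntzPair.exists_dualPair (hS : IsCuntzPair S₁ S₂) {σ : A ≃⋆ₐ[ℂ] A} (h1 : σ S₁ = S₂)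
    (h2 : σ S₂ = S₁) : ∃ (d : DualPair σ) (c : ℂ), c ≠ 0 ∧ d.φ S₁ = c • (S₁ + S₂) ∧
      (d.W : A) * (S₁ + S₂) = S₁ - S₂ := by
  have hs := CuntzRel.of_isometries hS.isometry₁ hS.isometry₂ hS.cuntz_relation
  have h12 : star S₁ * S₂ = 0 := by simpa using hs.orthonormal 0 1
  have h21 : star S₂ * S₁ = 0 := by simpa using hs.orthonormal 1 0
  have h11 := hS.isometry₁
  have h22 := hS.isometry₂
  set W : A := S₁ * star S₁ - S₂ * star S₂ with hW
  have hWs : star W = W := by simp [hW]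
  have hW1 : W * S₁ = S₁ := by
    rw [hW, sub_mul, mul_assoc, mul_assoc, h11, h21, mul_one, mul_zero, sub_zero]
  have hW2 : W * S₂ = -S₂ := by
    rw [hW, sub_mul, mul_assoc, mul_assoc, h12, h22, mul_one, mul_zero, zero_sub]
  have hWW : W * W = 1 := by
    nth_rewrite 2 [hW]
    rw [mul_sub, ← mul_assoc, ← mul_assoc, hW1, hW2, neg_mul, sub_neg_eq_add, hS.cuntz_relation]
  have hσW : σ W = -W := by
    simp only [hW, map_sub, map_mul, map_star, h1, h2, neg_sub]
  -- c = 1/√2 normalises S₁ + S₂, because (S₁ + S₂)*(S₁ + S₂) = 2.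
  obtain ⟨c, hc0, hc⟩ : ∃ c : ℂ, c ≠ 0 ∧ star c * c = 2⁻¹ := by
    refine ⟨((Real.sqrt 2)⁻¹ : ℝ), by simp, ?_⟩
    rw [← starRingEnd_apply, Complex.conj_ofReal, ← Complex.ofReal_mul, ← mul_inv,
      Real.mul_self_sqrt (by norm_num)]
    norm_num
  have hc' : c * star c = 2⁻¹ := by rw [mul_comm, hc]
  set X : A := c • (S₁ + S₂) with hX
  have half : (2 : ℂ)⁻¹ • (1 + 1 : A) = 1 := by
    rw [← two_smul ℂ (1 : A), smul_smul, inv_mul_cancel₀ two_ne_zero, one_smul]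
  have hXX : star X * X = 1 := by
    rw [hX, star_smul, smul_mul_smul_comm, hc, star_add, add_mul, mul_add, mul_add, h11, h12, h21,
      h22, add_zero, zero_add, half]
  have hWX : W * X = c • (S₁ - S₂) := by
    rw [hX, mul_smul_comm, mul_add, hW1, hW2, sub_eq_add_neg]
  have hYY : star (W * X * W) * (W * X * W) = 1 := by
    calc star (W * X * W) * (W * X * W) = W * star X * (W * W) * X * W := by
          rw [StarMul.star_mul, StarMul.star_mul, hWs]; noncomm_ring
      _ = W * (star X * X) * W := by rw [hWW]; noncomm_ring
      _ = 1 := by rw [hXX, mul_one, hWW]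
  have hsum : X * star X + W * X * W * star (W * X * W) = 1 := by
    have e : W * X * W * star (W * X * W) = (W * X) * star (W * X) := by
      calc W * X * W * star (W * X * W) = W * X * (W * W) * star (W * X) := by
            rw [StarMul.star_mul (W * X), hWs]; noncomm_ring
        _ = _ := by rw [hWW, mul_one]
    rw [e, hWX, hX, star_smul, star_smul, smul_mul_smul_comm, smul_mul_smul_comm, hc', ← smul_add]
    have : (S₁ + S₂) * star (S₁ + S₂) + (S₁ - S₂) * star (S₁ - S₂) = 1 + 1 := by
      nth_rewrite 1 [← hS.cuntz_relation]
      nth_rewrite 1 [← hS.cuntz_relation]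
      rw [star_add, star_sub]
      noncomm_ring
    rw [this, half]
  -- Covariance forces the second image: φ(S₂) = φ(σ(S₁)) = Wφ(S₁)W.
  obtain ⟨φ, hφ, f1, f2⟩ := hS.exists_starAlgHom (r := ![X, W * X * W])
    (CuntzRel.of_isometries hXX hYY hsum)
  simp only [Matrix.cons_val_zero, Matrix.cons_val_one] at f1 f2
  have hσX : σ X = X := by rw [hX, map_smul, map_add, h1, h2, add_comm]
  let Wu : unitary A := ⟨W, Unitary.mem_iff.2 (by rw [hWs]; exact ⟨hWW, hWW⟩)⟩
  have hfix : (σ : A →⋆ₐ[ℂ] A).comp φ = φ := by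
    refine StarAlgHom.ext_of_adjoin_dense hS.generates ?_
    rintro _ (rfl | rfl)
    · change σ (φ _) = _
      rw [f1, hσX]
    · change σ (φ _) = _
      rw [f2, map_mul, map_mul, hσW, hσX]; noncomm_ring
  have hcov : (Unitary.conjStarAlgAut ℂ A Wu : A →⋆ₐ[ℂ] A).comp φ
      = φ.comp (σ : A →⋆ₐ[ℂ] A) := by
    refine StarAlgHom.ext_of_adjoin_dense hS.generates ?_
    rintro _ (rfl | rfl)
    · change W * φ _ * star W = φ (σ _)
      rw [h1, f1, f2, hWs]
    · change W * φ _ * star W = φ (σ _)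
      rw [h2, f1, f2, hWs]
      calc W * (W * X * W) * W = (W * W) * X * (W * W) := by noncomm_ring
        _ = X := by rw [hWW, one_mul, mul_one]
  refine ⟨⟨φ, Wu, hφ, DFunLike.congr_fun hfix, DFunLike.congr_fun hcov, hWs, hσW⟩, c, hc0, f1, ?_⟩
  change W * (S₁ + S₂) = S₁ - S₂
  rw [mul_add, hW1, hW2, sub_eq_add_neg]

end Flip

end

theorem mainTheorem7 {A : Type u} [CStarAlgebra A] [Nontrivial A] (S₁ S₂ : A)
    (hS : IsCuntzPair S₁ S₂) :
    (∃! σ : A ≃⋆ₐ[ℂ] A, σ S₁ = S₂ ∧ σ S₂ = S₁) ∧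
      ∀ σ : A ≃⋆ₐ[ℂ] A, σ S₁ = S₂ → σ S₂ = S₁ →
        Nonempty (CrossedProduct σ ≃⋆ₐ[ℂ] twistedPaths σ) := by
  refine ⟨hS.existsUnique_flip, fun σ h1 h2 => ?_⟩
  obtain ⟨d, c, hc, hφ, hW⟩ := hS.exists_dualPair h1 h2
  have hσ : ((σ : A →⋆ₐ[ℂ] A).comp (σ : A →⋆ₐ[ℂ] A)) = StarAlgHom.id ℂ A := by
    refine StarAlgHom.ext_of_adjoin_dense hS.generates ?_
    rintro _ (rfl | rfl) <;> simp [h1, h2]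
  have hb : d.φ (c⁻¹ • S₁) = S₁ + S₂ := by
    rw [map_smul, hφ, smul_smul, inv_mul_cancel₀ hc, one_smul]
  refine d.nonempty_starAlgEquiv (DFunLike.congr_fun hσ) hS.generates ?_ ?_
  · rintro _ (h | h) <;> rw [h]
    · exact ⟨c⁻¹ • S₁, by rw [hb, h1]⟩
    · exact ⟨c⁻¹ • S₁, by rw [hb, h2, add_comm]⟩
  · rintro _ (h | h) <;> rw [h]
    · exact ⟨c⁻¹ • S₁, by rw [hb, h1, hW]⟩
    · exact ⟨-(c⁻¹ • S₁), by rw [map_neg, hb, h2, mul_neg, hW, neg_sub]⟩
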